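/- Let $\Lambda$ be the ring of symmetric functions over $\mathbb{Z}$ in countably many variables $x_1,x_2,\dots$ (invariant formal power series of bounded degree), let $h_r\in\Lambda$ be the complete homogeneous symmetric functions ($h_0=1$, $h_r=0$ for $r<0$), and let $\mathcal{P}$ be the set of all partitions. For $\lambda\in\mathcal{P}$ with $\ell$ nonzero parts let $\mathtt{s}^{\mathfrak{gl}}_\lambda=\det\big(h_{\lambda_i-i+j}\big)_{1\le i,j\le \ell}$ be the Schur function, and let $$\mathtt{s}^{\mathfrak{so}}_\lambda=\det\big(h_{\lambda_i-i+j}-h_{\lambda_i-i-j}\big)_{1\le i,j\le \ell},\qquad \mathtt{s}^{\mathfrak{sp}}_\lambda=\det\big(a_{ij}\big)_{1\le i,j\le \ell},\quad a_{i1}=h_{\lambda_i-i+1},\quad a_{ij}=h_{\lambda_i-i+j}+h_{\lambda_i-i-j+2}\ (j\ge 2),$$ be the universal orthogonal and symplectic characters of Koike and Terada. Let $c^{\nu}_{\lambda,\gamma}$ be the Littlewood--Richardson coefficients, $\mathtt{s}^{\mathfrak{gl}}_\lambda\mathtt{s}^{\mathfrak{gl}}_\gamma=\sum_\nu c^\nu_{\lambda,\gamma}\mathtt{s}^{\mathfrak{gl}}_\nu$.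 Let $\mathcal{P}^{(2)}$ (resp. $\mathcal{P}^{(1,1)}$) be the set of partitions all of whose rows (resp. columns) have even length, and let $\mathcal{P}^{(2)}(2k)$, $\mathcal{P}^{(1,1)}(2k)$ be their subsets of partitions of size $2k$. For $k\in\mathbb{N}$ and $\lambda\in\mathcal{P}$ put $$m^{\mathfrak{so}}_{k,\lambda}=\sum_{\nu\in\mathcal{P}^{(1,1)}(2k)}\ \sum_{\gamma\in\mathcal{P}^{(2)}}c^\nu_{\lambda,\gamma},\qquad m^{\mathfrak{sp}}_{k,\lambda}=\sum_{\nu\in\mathcal{P}^{(2)}(2k)}\ \sum_{\gamma\in\mathcal{P}^{(1,1)}}c^\nu_{\lambda,\gamma}.$$ Then, for each $k$, only finitely many triples $(\lambda,\nu,\gamma)$ contribute a nonzero term to these sums (so that the sums below over $\lambda$ are finite for each $k$), the infinite products below converge coefficientwise to elements of $\Lambda[[q]]$ (the universal graded characters $\mathrm{char}_q(\mathtt{S}(\mathfrak{so}))$ and $\mathrm{char}_q(\mathtt{S}(\mathfrak{sp}))$), and in $\Lambda[[q]]$ $$\prod_{i<j}\frac{1}{1-q x_i x_j}=\sum_{k\ge0}\sum_{\lambda\in\mathcal{P}}m^{\mathfrak{so}}_{k,\lambda}\,\mathtt{s}^{\mathfrak{so}}_\lambda\,q^k,\qquad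 \prod_{i\le j}\frac{1}{1-q x_i x_j}=\sum_{k\ge0}\sum_{\lambda\in\mathcal{P}}m^{\mathfrak{sp}}_{k,\lambda}\,\mathtt{s}^{\mathfrak{sp}}_\lambda\,q^k.$$ -/

import Mathlib

open scoped MvPowerSeries.WithPiTopology PowerSeries.WithPiTopology

namespace UniversalCharacters

/-- The ring `Λ` of symmetric functions over `ℤ` in countably many variables `x_0, x_1, x_2, …`:
the formal power series of bounded degree that are invariant under all permutations of the
variables. -/
def Lam : Subring (MvPowerSeries ℕ ℤ) where
  carrier := {f | (∃ d : ℕ, ∀ m : ℕ →₀ ℕ, d < m.degree → MvPowerSeries.coeff m f = 0) ∧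
    ∀ σ : Equiv.Perm ℕ, MvPowerSeries.renameEquiv ℤ σ f = f}
  mul_mem' := by
    rintro f g ⟨⟨d, hd⟩, hf⟩ ⟨⟨e, he⟩, hg⟩
    refine ⟨⟨d + e, fun m hm => ?_⟩, fun σ => by rw [map_mul, hf, hg]⟩
    classical
    rw [MvPowerSeries.coeff_mul]
    refine Finset.sum_eq_zero fun p hp => ?_
    replace hp : p.1 + p.2 = m := Finset.HasAntidiagonal.mem_antidiagonal.mp hp
    have h : p.1.degree + p.2.degree = m.degree := by rw [← hp, map_add]
    by_cases h1 : d < p.1.degree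
    · rw [hd _ h1, zero_mul]
    · rw [he p.2 (by omega), mul_zero]
  one_mem' := by
    classical
    refine ⟨⟨0, fun m hm => ?_⟩, fun σ => map_one _⟩
    rw [MvPowerSeries.coeff_one, if_neg]
    rintro rfl
    simp at hm
  add_mem' := by
    rintro f g ⟨⟨d, hd⟩, hf⟩ ⟨⟨e, he⟩, hg⟩
    refine ⟨⟨d + e, fun m hm => ?_⟩, fun σ => by rw [map_add, hf, hg]⟩
    rw [map_add, hd m (by omega), he m (by omega), add_zero]
  zero_mem' := ⟨⟨0, fun m _ => by simp⟩, fun σ => map_zero _⟩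
  neg_mem' := by
    rintro f ⟨⟨d, hd⟩, hf⟩
    refine ⟨⟨d, fun m hm => ?_⟩, fun σ => by rw [map_neg, hf]⟩
    rw [map_neg, hd m hm, neg_zero]

/-- The complete homogeneous symmetric function `h_r`, the sum of all monomials of degree `r`
(so `h_0 = 1`, and `h_r = 0` for `r < 0`). -/
noncomputable def h (r : ℤ) : Lam :=
  ⟨fun m : ℕ →₀ ℕ => if (m.degree : ℤ) = r then 1 else 0, by
    constructor
    · refine ⟨r.toNat, fun m hm => ?_⟩
      change (if (m.degree : ℤ) = r then (1 : ℤ) else 0) = 0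
      rw [if_neg]
      omega
    · intro σ
      ext m
      have key : ∀ n : ℕ →₀ ℕ, (Finsupp.embDomain σ.toEmbedding n).degree = n.degree := by
        intro n
        exact Finsupp.sum_embDomain (v := n) (f := σ.toEmbedding) (g := fun _ x => x)
      have hm : m = Finsupp.embDomain σ.toEmbedding (Finsupp.embDomain σ.symm.toEmbedding m) := by
        ext i
        have h1 := Finsupp.embDomain_apply_self σ.toEmbedding
          (Finsupp.embDomain σ.symm.toEmbedding m) (σ.symm i)
        have h2 := Finsupp.embDomain_apply_self σ.symm.toEmbedding m i
        simp only [Equiv.coe_toEmbedding, Equiv.apply_symm_apply] at h1 h2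
        rw [h1, h2]
      rw [hm]
      generalize Finsupp.embDomain σ.symm.toEmbedding m = n
      have h3 := MvPowerSeries.coeff_embDomain_rename (R := ℤ) σ.toEmbedding
        (fun m : ℕ →₀ ℕ => if (m.degree : ℤ) = r then 1 else 0) n
      refine Eq.trans h3 ?_
      change (if (n.degree : ℤ) = r then (1 : ℤ) else 0) =
        (if ((Finsupp.embDomain σ.toEmbedding n).degree : ℤ) = r then (1 : ℤ) else 0)
      rw [key]⟩

/-! Partitions are Young diagrams: with rows and columns numbered from `0`, the `i`-th part of `μ`
is `μ.rowLen i`, the number of nonzero parts is `μ.colLen 0`, and the size is `μ.card`. -/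

/-- The Schur function `s^{gl}_μ = det (h_{μ_i - i + j})` (universal character of type `gl`). -/
noncomputable def sGl (μ : YoungDiagram) : Lam :=
  Matrix.det (Matrix.of fun i j : Fin (μ.colLen 0) =>
    h ((μ.rowLen i : ℤ) - (i : ℤ) + (j : ℤ)))

/-- The universal orthogonal character of Koike and Terada,
`s^{so}_μ = det (h_{μ_i - i + j} - h_{μ_i - i - j})`, where `i, j ≥ 1`.
Below, `i` and `j` start at `0`. -/
noncomputable def sSo (μ : YoungDiagram) : Lam :=
  Matrix.det (Matrix.of fun i j : Fin (μ.colLen 0) =>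
    h ((μ.rowLen i : ℤ) - (i : ℤ) + (j : ℤ)) - h ((μ.rowLen i : ℤ) - (i : ℤ) - (j : ℤ) - 2))

/-- The universal symplectic character of Koike and Terada: the determinant with first column
`h_{μ_i - i + 1}` and with entries `h_{μ_i - i + j} + h_{μ_i - i - j + 2}` in the columns `j ≥ 2`,
where `i, j ≥ 1`. Below, `i` and `j` start at `0`. -/
noncomputable def sSp (μ : YoungDiagram) : Lam :=
  Matrix.det (Matrix.of fun i j : Fin (μ.colLen 0) =>
    if (j : ℕ) = 0 then h ((μ.rowLen i : ℤ) - (i : ℤ))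
    else h ((μ.rowLen i : ℤ) - (i : ℤ) + (j : ℤ)) + h ((μ.rowLen i : ℤ) - (i : ℤ) - (j : ℤ)))

/-- The Littlewood-Richardson coefficient `c^ν_{μ,γ}`: the coefficient of `s^{gl}_ν` in the
expansion of `s^{gl}_μ s^{gl}_γ` as a `ℤ`-linear combination of Schur functions. (Schur functions
are a `ℤ`-basis of `Λ`, so the linear combination map is bijective and `Function.invFun` is its
inverse.) -/
noncomputable def lrCoeff (μ γ ν : YoungDiagram) : ℤ :=
  Function.invFun (fun c : YoungDiagram →₀ ℤ => Finsupp.linearCombination ℤ sGl c)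
    (sGl μ * sGl γ) ν

/-- Partitions all of whose rows have even length, the set `𝒫^{(2)}`. -/
def evenRows : Set YoungDiagram := {μ | ∀ i, Even (μ.rowLen i)}

/-- Partitions all of whose columns have even length, the set `𝒫^{(1,1)}`. -/
def evenCols : Set YoungDiagram := {μ | ∀ j, Even (μ.colLen j)}

/-- `m^{so}_{k,μ} = ∑_{ν ∈ 𝒫^{(1,1)}, |ν| = 2k} ∑_{γ ∈ 𝒫^{(2)}} c^ν_{μ,γ}`. -/
noncomputable def mSo (k : ℕ) (μ : YoungDiagram) : ℤ :=
  ∑ᶠ ν ∈ {ν : YoungDiagram | ν ∈ evenCols ∧ ν.card = 2 * k}, ∑ᶠ γ ∈ evenRows, lrCoeff μ γ ν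

/-- `m^{sp}_{k,μ} = ∑_{ν ∈ 𝒫^{(2)}, |ν| = 2k} ∑_{γ ∈ 𝒫^{(1,1)}} c^ν_{μ,γ}`. -/
noncomputable def mSp (k : ℕ) (μ : YoungDiagram) : ℤ :=
  ∑ᶠ ν ∈ {ν : YoungDiagram | ν ∈ evenRows ∧ ν.card = 2 * k}, ∑ᶠ γ ∈ evenCols, lrCoeff μ γ ν

/-- The factor `1 / (1 - q x_i x_j)` in `ℤ[[x_0, x_1, …]][[q]]`, the inverse of a power series
in `q` with constant coefficient `1`. -/
noncomputable def factor (i j : ℕ) : PowerSeries (MvPowerSeries ℕ ℤ) :=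
  PowerSeries.invOfUnit
    (1 - PowerSeries.X * PowerSeries.C (MvPowerSeries.X i * MvPowerSeries.X j)) 1

/-- `F ∈ Λ[[q]]` is the universal graded character `∏_{i < j} 1 / (1 - q x_i x_j)` of type `so`:
the infinite product converges (coefficientwise) to `F`. -/
def IsCharSo (F : PowerSeries Lam) : Prop :=
  HasProd (fun p : {p : ℕ × ℕ // p.1 < p.2} => factor p.1.1 p.1.2)
    (PowerSeries.map Lam.subtype F)

/-- `F ∈ Λ[[q]]` is the universal graded character `∏_{i ≤ j} 1 / (1 - q x_i x_j)` of type `sp`: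
the infinite product converges (coefficientwise) to `F`. -/
def IsCharSp (F : PowerSeries Lam) : Prop :=
  HasProd (fun p : {p : ℕ × ℕ // p.1 ≤ p.2} => factor p.1.1 p.1.2)
    (PowerSeries.map Lam.subtype F)

end UniversalCharacters

/-! Two classical facts combine. Littlewood's identities say that `∏_{i<j} 1/(1 - q x_i x_j)` is the
sum of `q^(|ν|/2) s_ν` over `ν` with even columns, and that `∏_{i≤j} 1/(1 - q x_i x_j)` is the same
sum over `ν` with even rows. The branching rules say that `s_ν = ∑ c^ν_{μ,γ} s^so_μ` with `γ`
running over even rows, and `s_ν = ∑ c^ν_{μ,γ} s^sp_μ` with `γ` running over even columns.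
Substituting the second fact into the first and exchanging finite sums produces the multiplicities.

Everything is proved in `n` variables with alternants `a_α = det (t_i^{α_j})`, for `n` large
compared with the degree in play. Littlewood's identities (`evenConj_altSeries`,
`evenParts_altSeries`) go by induction on `n`: either the last part is zero, or columns of full
height can be stripped off. The inductive step is a determinantal identity (`sum_ker_identity`,
`sum_ker_diag_identity`).

For the branching rules (`branching`), let `G = a_δ ∏ H(t_i)`, whose coefficient at `t^(λ+δ)` is
`s_λ` by Jacobi-Trudi. By Weyl-type denominator formulas, multiplying `G` by `∏_{i<j} (1 - t_i
t_j)`, or by `∏_{i≤j} (1 - t_i t_j)`, turns these coefficients into `s^sp_λ`, or `s^so_λ`.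
Littlewood's identities invert these kernels, and comparing coefficients of alternants gives the
rules. So each orthogonal or symplectic formula uses both Littlewood identities, one for `ν` and the
other for `γ`. -/

namespace UniversalCharacters

/-! ### Alternants, Vandermonde products, and the kernels `∏ (1 - q t_i t_j)`. -/

section Alternants

variable {A : Type*} [CommRing A] {n : ℕ}

/-- The alternant `det (t_i ^ α_j)`. -/
def alt (t : Fin n → A) (α : Fin n → ℕ) : A := Matrix.det (Matrix.of fun i j => t i ^ α j)

/-- The exponents `(n - 1, …, 1, 0)`. -/
def stair (n : ℕ) : Fin n → ℕ := fun i => (Fin.rev i : ℕ)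

/-- The Vandermonde determinant `∏_{i < j} (t_i - t_j)`. -/
def vand (t : Fin n → A) : A := alt t (stair n)

theorem vand_eq_prod (t : Fin n → A) : vand t = ∏ i, ∏ j ∈ Finset.Ioi i, (t i - t j) := by
  have := Matrix.det_projVandermonde (fun _ => 1) t
  simp only [one_mul] at this
  rw [← this, vand, alt]
  congr 1
  ext i j
  simp [Matrix.projVandermonde_apply, stair]

theorem alt_perm (t : Fin n → A) (α : Fin n → ℕ) (σ : Equiv.Perm (Fin n)) :
    alt t (α ∘ σ) = (Equiv.Perm.sign σ : ℤ) * alt t α :=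
  Matrix.det_permute' σ (Matrix.of fun i j => t i ^ α j)

theorem alt_eq_zero (t : Fin n → A) {α : Fin n → ℕ} {i j : Fin n} (hij : i ≠ j)
    (hα : α i = α j) : alt t α = 0 :=
  Matrix.det_zero_of_column_eq hij fun k => by simp [hα]

theorem alt_add_const (t : Fin n → A) (α : Fin n → ℕ) (s : ℕ) :
    alt t (fun i => α i + s) = (∏ i, t i) ^ s * alt t α := by
  rw [alt, alt, ← Finset.prod_pow, ← Matrix.det_mul_column]
  congr 1
  ext i j
  simp [pow_add, mul_comm]

/-- The last column consists of ones, so Laplace expansion along it leaves alternants in one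
variable fewer, with a factor `t_i` pulled out of every remaining row. -/
theorem alt_snoc_zero (t : Fin (n + 1) → A) (α : Fin (n + 1) → ℕ) (β : Fin n → ℕ)
    (h0 : α (Fin.last n) = 0) (hs : ∀ i, α (Fin.castSucc i) = β i + 1) :
    alt t α = ∑ k : Fin (n + 1), (-1) ^ ((k : ℕ) + n) *
      ((∏ i, t (k.succAbove i)) * alt (fun i => t (k.succAbove i)) β) := by
  rw [alt, Matrix.det_succ_column _ (Fin.last n)]
  refine Finset.sum_congr rfl fun k _ => ?_
  have := alt_add_const (fun i => t (k.succAbove i)) β 1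
  rw [pow_one] at this
  rw [← this]
  simp only [Matrix.of_apply, h0, pow_zero, mul_one, Fin.val_last]
  congr 1
  rw [alt]
  congr 1
  ext i j
  simp [hs]

/-- Both sides are the trace of `adjugate M * N`. This trades a sum over the distinguished variable
for a sum over the modified exponent. -/
theorem sum_det_updateRow {ι : Type*} [Fintype ι] [DecidableEq ι] (M N : Matrix ι ι A) :
    ∑ k, (M.updateRow k (N k)).det = ∑ c, (M.updateCol c fun i => N i c).det := by
  have h1 : ∀ c, (M.updateCol c fun i => N i c).det = ∑ k, M.adjugate c k * N k c := fun c => by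
    rw [← Matrix.cramer_apply, Matrix.cramer_eq_adjugate_mulVec]
    rfl
  have h2 : ∀ k, (M.updateRow k (N k)).det = ∑ c, M.adjugate c k * N k c := fun k => by
    rw [← Matrix.cramer_transpose_apply, Matrix.cramer_eq_adjugate_mulVec,
      ← Matrix.adjugate_transpose]
    rfl
  simp_rw [h1, h2]
  exact Finset.sum_comm

/-- The product of a symmetric function of two arguments over the pairs `i < j`. -/
def pairProd (n : ℕ) (f : Fin n → Fin n → A) : A := ∏ i, ∏ j, if i < j then f i j else 1

theorem pairProd_eq (f : Fin n → Fin n → A) :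
    pairProd n f = ∏ i, ∏ j ∈ Finset.Ioi i, f i j := by
  refine Finset.prod_congr rfl fun i _ => ?_
  rw [← Finset.prod_filter]
  congr 1
  ext j
  simp

theorem pairProd_succAbove (f : Fin (n + 1) → Fin (n + 1) → A) (k : Fin (n + 1)) :
    pairProd (n + 1) f = pairProd n (fun i j => f (k.succAbove i) (k.succAbove j)) *
      ∏ i : Fin n, if k.succAbove i < k then f (k.succAbove i) k else f k (k.succAbove i) := by
  rw [pairProd, Fin.prod_univ_succAbove _ k]
  simp_rw [Fin.prod_univ_succAbove _ k, Fin.succAbove_lt_succAbove_iff]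
  rw [Finset.prod_mul_distrib, if_neg (lt_irrefl k), one_mul, ← mul_assoc,
    ← Finset.prod_mul_distrib, mul_comm, pairProd]
  congr 1
  refine Finset.prod_congr rfl fun i _ => ?_
  rcases lt_or_gt_of_ne (Fin.succAbove_ne k i) with h | h
  · simp [h, h.not_gt]
  · simp [h, h.not_gt]

theorem prod_neg_one_succAbove (k : Fin (n + 1)) :
    (∏ i : Fin n, if k.succAbove i < k then (-1 : A) else 1) = (-1) ^ (k : ℕ) := by
  have : ∀ i : Fin n, (if k.succAbove i < k then (-1 : A) else 1) =
      if (i : ℕ) < k then (-1 : A) else 1 := fun i => by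
    congr 1
    rw [Fin.succAbove_lt_iff_castSucc_lt]
    rfl
  simp_rw [this]
  rw [Fin.prod_univ_eq_prod_range (fun i => if i < (k : ℕ) then (-1 : A) else 1) n,
    Finset.prod_ite, Finset.prod_const, Finset.prod_const_one, mul_one]
  congr 1
  have : Finset.filter (· < (k : ℕ)) (Finset.range n) = Finset.range k := by
    ext i
    have := k.is_lt
    simp only [Finset.mem_filter, Finset.mem_range]
    omega
  rw [this, Finset.card_range]

/-- The product of `1 - q t_i t_j` over the pairs `i < j`. -/
def ker (q : A) (t : Fin n → A) : A := pairProd n fun i j => 1 - q * (t i * t j)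

/-- The product of `1 - q t_i²`. -/
def kerDiag (q : A) (t : Fin n → A) : A := ∏ i, (1 - q * (t i * t i))

theorem ker_succAbove (q : A) (t : Fin (n + 1) → A) (k : Fin (n + 1)) :
    ker q t = ker q (fun i => t (k.succAbove i)) *
      ∏ i : Fin n, (1 - q * (t k * t (k.succAbove i))) := by
  rw [ker, pairProd_succAbove _ k, ker]
  congr 1
  refine Finset.prod_congr rfl fun i _ => ?_
  split_ifs
  · rw [mul_comm (t _)]
  · rfl

theorem kerDiag_succAbove (q : A) (t : Fin (n + 1) → A) (k : Fin (n + 1)) :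
    kerDiag q t = kerDiag q (fun i => t (k.succAbove i)) * (1 - q * (t k * t k)) := by
  rw [kerDiag, Fin.prod_univ_succAbove _ k, mul_comm, kerDiag]

/-- This puts the summands of the inductive step into the shape required by `sum_det_updateRow`. -/
theorem vand_mul_prod_eq_det (q : A) (t : Fin (n + 1) → A) (k : Fin (n + 1)) :
    (-1) ^ (k : ℕ) * ((∏ i, t (k.succAbove i)) * vand (fun i => t (k.succAbove i)) *
      ∏ i : Fin n, (1 - q * (t k * t (k.succAbove i)))) =
    ((Matrix.of fun i j : Fin (n + 1) => t i ^ (stair (n + 1) j + 1)).updateRow k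
      fun j => (q * t k) ^ (j : ℕ)).det := by
  -- A projective Vandermonde at the points `(1 : t_i)` for `i ≠ k` and `(q t_k : 1)` for `i = k`.
  -- The factors `v_j w_i - v_i w_j` are `t_i - t_j` away from `k`, and `±(1 - q t_k t_i)`
  -- otherwise; the negative signs come from the indices below `k`.
  set v : Fin (n + 1) → A := fun i => if i = k then q * t k else 1 with hv
  set w : Fin (n + 1) → A := fun i => if i = k then 1 else t i with hw
  have h1 : ((Matrix.of fun i j : Fin (n + 1) => t i ^ (stair (n + 1) j + 1)).updateRow k
      fun j => (q * t k) ^ (j : ℕ)) = Matrix.of fun i j => w i * Matrix.projVandermonde v w i j := by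
    ext i j
    by_cases hik : i = k
    · subst hik
      simp [hv, hw, Matrix.projVandermonde_apply]
    · simp [hv, hw, Matrix.projVandermonde_apply, hik, stair, pow_succ']
  have hne : ∀ i, k.succAbove i ≠ k := Fin.succAbove_ne k
  rw [h1, Matrix.det_mul_column, Matrix.det_projVandermonde, Fin.prod_univ_succAbove w k,
    ← pairProd_eq (fun i j => v j * w i - v i * w j), pairProd_succAbove _ k, vand_eq_prod,
    ← pairProd_eq (fun i j => t (k.succAbove i) - t (k.succAbove j)),
    ← prod_neg_one_succAbove k]
  simp only [hv, hw, hne, if_true, if_false, one_mul, mul_one]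
  rw [mul_comm, mul_assoc, mul_assoc, ← Finset.prod_mul_distrib]
  congr 2
  refine Finset.prod_congr rfl fun i _ => ?_
  split_ifs <;> ring

theorem updateCol_alt (t : Fin n → A) (α : Fin n → ℕ) (c : Fin n) (e : ℕ) (x : A) :
    ((Matrix.of fun i j : Fin n => t i ^ α j).updateCol c fun i => x * t i ^ e).det =
      x * alt t (Function.update α c e) := by
  have : (fun i => x * t i ^ e) = x • fun i => t i ^ e := rfl
  rw [this, Matrix.det_updateCol_smul, alt]
  congr 2
  ext i j
  by_cases hj : j = c
  · subst hj
    simp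
  · simp [Matrix.updateCol_ne hj, Function.update_of_ne hj]

end Alternants

/-! ### The determinantal identities behind the inductive step of Littlewood's identities. -/

section KeyIdentity

variable {A : Type*} [CommRing A] {n : ℕ}

theorem alt_comp_finRotate (t : Fin (n + 1) → A) (α : Fin (n + 1) → ℕ) :
    alt t (α ∘ finRotate (n + 1)) = (-1) ^ n * alt t α := by
  rw [alt_perm, sign_finRotate]
  simp

theorem stair_apply (i : Fin n) : stair n i = n - 1 - i := by
  rw [stair, Fin.val_rev]
  omega

theorem finRotate_apply_val (i : Fin (n + 1)) :
    (finRotate (n + 1) i : ℕ) = if (i : ℕ) = n then 0 else (i : ℕ) + 1 := by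
  split_ifs with h
  · have : i = Fin.last n := Fin.ext h
    rw [this, finRotate_last]
    simp
  · have : i ≠ Fin.last n := fun h' => h (by rw [h']; rfl)
    exact coe_finRotate_of_ne_last this

/-- Column `j` has exponent `n + 1 - j`, so the new exponent `c` already occurs in column `n + 1 -
c`. Two equal columns give zero, except when `c = 0` (a cyclic shift of the staircase) or when that
column is `c` itself. -/
theorem alt_update_diag (t : Fin (n + 1) → A) (c : Fin (n + 1)) :
    alt t (Function.update (fun j => stair (n + 1) j + 1) c c) =
      (if (c : ℕ) = 0 then (-1) ^ n * vand t else 0) +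
        if 2 * (c : ℕ) = n + 1 then (∏ i, t i) * vand t else 0 := by
  by_cases h0 : (c : ℕ) = 0
  · rw [if_pos h0, if_neg (by omega), add_zero, vand]
    have : stair (n + 1) =
        Function.update (fun j => stair (n + 1) j + 1) c c ∘ finRotate (n + 1) := by
      ext j
      simp only [Function.comp_apply, Function.update_apply, Fin.ext_iff, finRotate_apply_val,
        stair_apply, h0]
      have := j.is_lt
      split_ifs <;> first | omega | contradiction
    conv_rhs => rw [this, alt_comp_finRotate, ← mul_assoc, ← mul_pow]
    simp
  · rw [if_neg h0, zero_add]
    split_ifs with h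
    · have : Function.update (fun j => stair (n + 1) j + 1) c c =
          fun j => stair (n + 1) j + 1 := by
        rw [Function.update_eq_self_iff, stair_apply]
        omega
      rw [this, alt_add_const, pow_one, vand]
    · have hc := c.is_lt
      refine alt_eq_zero t (i := c) (j := ⟨n + 1 - c, by omega⟩) (by
        rw [Ne, Fin.ext_iff]
        simp only
        omega) ?_
      rw [Function.update_self, Function.update_of_ne (by
        rw [Ne, Fin.ext_iff]
        simp only
        omega), stair_apply]
      simp only
      omega

/-- The exponent `c + 2` occurs in column `n + 1 - (c + 2)`. The exceptions are `c = n`, where `n +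
2` is a new largest exponent, and the case where that column is `c` itself. -/
theorem alt_update_diag_add_two (t : Fin (n + 1) → A) (c : Fin (n + 1)) :
    alt t (Function.update (fun j => stair (n + 1) j + 1) c (c + 2)) =
      (if (c : ℕ) = n then (-1) ^ n * ((∏ i, t i) ^ 2 * vand t) else 0) +
        if 2 * (c : ℕ) + 2 = n + 1 then (∏ i, t i) * vand t else 0 := by
  have hc := c.is_lt
  by_cases h0 : (c : ℕ) = n
  · rw [if_pos h0, if_neg (by omega), add_zero, vand, ← alt_add_const, ← alt_comp_finRotate]
    congr 1
    ext j
    simp only [Function.comp_apply, Function.update_apply, Fin.ext_iff, finRotate_apply_val,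
      stair_apply, h0]
    have := j.is_lt
    split_ifs <;> omega
  · rw [if_neg h0, zero_add]
    split_ifs with h
    · have : Function.update (fun j => stair (n + 1) j + 1) c (c + 2) =
          fun j => stair (n + 1) j + 1 := by
        rw [Function.update_eq_self_iff, stair_apply]
        omega
      rw [this, alt_add_const, pow_one, vand]
    · refine alt_eq_zero t (i := c) (j := ⟨n + 1 - (c + 2), by omega⟩) (by
        rw [Ne, Fin.ext_iff]
        simp only
        omega) ?_
      rw [Function.update_self, Function.update_of_ne (by
        rw [Ne, Fin.ext_iff]
        simp only
        omega), stair_apply]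
      simp only
      omega

theorem sum_pow_mul_alt_update (q : A) (t : Fin (n + 1) → A) :
    ∑ c : Fin (n + 1), q ^ (c : ℕ) *
      alt t (Function.update (fun j => stair (n + 1) j + 1) c c) =
    (-1) ^ n * vand t + if Odd n then q ^ ((n + 1) / 2) * ((∏ i, t i) * vand t) else 0 := by
  simp_rw [alt_update_diag, mul_add, Finset.sum_add_distrib]
  congr 1
  · rw [Fin.sum_univ_succ]
    simp
  · split_ifs with h
    · obtain ⟨m, hm⟩ := h
      rw [Finset.sum_eq_single ⟨m + 1, by omega⟩]
      · rw [if_pos (by simp only; omega)]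
        congr 2
        simp only
        omega
      · intro c _ hc
        rw [if_neg, mul_zero]
        rw [Ne, Fin.ext_iff] at hc
        simp only at hc
        omega
      · simp
    · refine Finset.sum_eq_zero fun c _ => ?_
      rw [if_neg, mul_zero]
      rw [Nat.not_odd_iff_even] at h
      obtain ⟨m, hm⟩ := h
      omega

theorem sum_pow_mul_alt_update_add_two (q : A) (t : Fin (n + 1) → A) :
    ∑ c : Fin (n + 1), q ^ ((c : ℕ) + 1) *
      alt t (Function.update (fun j => stair (n + 1) j + 1) c (c + 2)) =
    (-1) ^ n * (q ^ (n + 1) * (∏ i, t i) ^ 2 * vand t) +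
      if Odd n then q ^ ((n + 1) / 2) * ((∏ i, t i) * vand t) else 0 := by
  simp_rw [alt_update_diag_add_two, mul_add, Finset.sum_add_distrib]
  congr 1
  · rw [Finset.sum_eq_single (Fin.last n)]
    · rw [if_pos (by simp)]
      simp only [Fin.val_last]
      ring
    · intro c _ hc
      rw [if_neg, mul_zero]
      rwa [Ne, Fin.ext_iff] at hc
    · simp
  · split_ifs with h
    · obtain ⟨m, hm⟩ := h
      rw [Finset.sum_eq_single ⟨m, by omega⟩]
      · rw [if_pos (by simp only; omega)]
        congr 2
        simp only
        omega
      · intro c _ hc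
        rw [if_neg, mul_zero]
        rw [Ne, Fin.ext_iff] at hc
        simp only at hc
        omega
      · simp
    · refine Finset.sum_eq_zero fun c _ => ?_
      rw [if_neg, mul_zero]
      rw [Nat.not_odd_iff_even] at h
      obtain ⟨m, hm⟩ := h
      omega

/-- By `vand_mul_prod_eq_det` the left side is a sum of determinants with one row replaced. After
passing to replaced columns, at most two terms survive. -/
theorem sum_ker_identity (q : A) (t : Fin (n + 1) → A) :
    ∑ k : Fin (n + 1), (-1) ^ ((k : ℕ) + n) * ((∏ i, t (k.succAbove i)) *
      vand (fun i => t (k.succAbove i)) * ∏ i : Fin n, (1 - q * (t k * t (k.succAbove i)))) =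
    (1 - if Odd n then q ^ ((n + 1) / 2) * ∏ i, t i else 0) * vand t := by
  have h1 : ∀ c : Fin (n + 1), (fun i => (q * t i) ^ (c : ℕ)) =
      fun i => q ^ (c : ℕ) * t i ^ (c : ℕ) := fun c => funext fun i => mul_pow _ _ _
  have h2 := sum_det_updateRow (Matrix.of fun i j : Fin (n + 1) => t i ^ (stair (n + 1) j + 1))
    (fun k j => (q * t k) ^ (j : ℕ))
  simp_rw [← vand_mul_prod_eq_det, h1, updateCol_alt, sum_pow_mul_alt_update] at h2
  simp_rw [pow_add, mul_comm _ ((-1 : A) ^ n), mul_assoc ((-1 : A) ^ n), ← Finset.mul_sum, h2,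
    mul_add, ← mul_assoc, ← mul_pow]
  split_ifs with h
  · rw [h.neg_one_pow]
    simp
    ring
  · simp

/-- The extra factor `1 - q t_k²` subtracts a second sum of replaced rows, with exponents shifted by
two. The middle terms `q^((n+1)/2)` of the two sums cancel, leaving the two extreme ones. -/
theorem sum_ker_diag_identity (q : A) (t : Fin (n + 1) → A) :
    ∑ k : Fin (n + 1), (-1) ^ ((k : ℕ) + n) * ((∏ i, t (k.succAbove i)) *
      vand (fun i => t (k.succAbove i)) *
        ((∏ i : Fin n, (1 - q * (t k * t (k.succAbove i)))) * (1 - q * (t k * t k)))) =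
    (1 - q ^ (n + 1) * (∏ i, t i) ^ 2) * vand t := by
  have h1 : ∀ c : Fin (n + 1), (fun i => (q * t i) ^ (c : ℕ)) =
      fun i => q ^ (c : ℕ) * t i ^ (c : ℕ) := fun c => funext fun i => mul_pow _ _ _
  have h3 : ∀ c : Fin (n + 1), (fun i => q * (t i * t i) * (q * t i) ^ (c : ℕ)) =
      fun i => q ^ ((c : ℕ) + 1) * t i ^ ((c : ℕ) + 2) := fun c => funext fun i => by
    rw [mul_pow]
    ring
  have h2 := sum_det_updateRow (Matrix.of fun i j : Fin (n + 1) => t i ^ (stair (n + 1) j + 1))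
    (fun k j => (q * t k) ^ (j : ℕ))
  have h4 := sum_det_updateRow (Matrix.of fun i j : Fin (n + 1) => t i ^ (stair (n + 1) j + 1))
    (fun k j => q * (t k * t k) * (q * t k) ^ (j : ℕ))
  have h5 : ∀ k : Fin (n + 1), (fun j : Fin (n + 1) => q * (t k * t k) * (q * t k) ^ (j : ℕ)) =
      (q * (t k * t k)) • fun j : Fin (n + 1) => (q * t k) ^ (j : ℕ) := fun k => rfl
  simp_rw [h3, updateCol_alt, sum_pow_mul_alt_update_add_two, h5, Matrix.det_updateRow_smul,
    ← vand_mul_prod_eq_det] at h4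
  simp_rw [← vand_mul_prod_eq_det, h1, updateCol_alt, sum_pow_mul_alt_update] at h2
  have h6 : ∀ k : Fin (n + 1), (-1) ^ ((k : ℕ) + n) * ((∏ i, t (k.succAbove i)) *
      vand (fun i => t (k.succAbove i)) *
        ((∏ i : Fin n, (1 - q * (t k * t (k.succAbove i)))) * (1 - q * (t k * t k)))) =
      (-1) ^ n * ((-1) ^ (k : ℕ) * ((∏ i, t (k.succAbove i)) *
        vand (fun i => t (k.succAbove i)) * ∏ i : Fin n, (1 - q * (t k * t (k.succAbove i)))) -
      (q * (t k * t k)) * ((-1) ^ (k : ℕ) * ((∏ i, t (k.succAbove i)) *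
        vand (fun i => t (k.succAbove i)) *
          ∏ i : Fin n, (1 - q * (t k * t (k.succAbove i)))))) := fun k => by ring
  simp_rw [h6, ← Finset.mul_sum, Finset.sum_sub_distrib, h2]
  rw [h4]
  have : ((-1 : A) ^ n) * (-1) ^ n = 1 := by rw [← mul_pow]; simp
  linear_combination (vand t - (q ^ (n + 1) * (∏ i, t i) ^ 2 * vand t)) * this

end KeyIdentity

/-! ### Weyl-type denominator formulas for the kernels at `q = 1`. -/

section WeylDenominators

variable {A : Type*} [CommRing A] {n : ℕ}

/-- Because `(1 + t_j²) t_i - (1 + t_i²) t_j = (t_i - t_j)(1 - t_i t_j)`. -/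
theorem mul_projVandermonde_one_add_sq (t : Fin n → A) :
    (Matrix.projVandermonde (fun i => 1 + t i ^ 2) t).det = vand t * ker 1 t := by
  rw [Matrix.det_projVandermonde, vand_eq_prod, ker, pairProd_eq, ← Finset.prod_mul_distrib]
  refine Finset.prod_congr rfl fun i _ => ?_
  rw [← Finset.prod_mul_distrib]
  refine Finset.prod_congr rfl fun j _ => ?_
  ring

/-- If the `j`-th column is a monic form of degree `j` in `v_i, w_i` times `w_i ^ (n - 1 - j)`,
the determinant is that of the projective Vandermonde matrix. -/
theorem det_monic_forms (v w : Fin n → A) (f : ℕ → Fin n → A) (c : ℕ → ℕ → A)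
    (hc : ∀ j, c j j = 1)
    (hf : ∀ j i, f j i = ∑ m ∈ Finset.range (j + 1), c j m * (v i ^ m * w i ^ (j - m))) :
    (Matrix.of fun i j : Fin n => f j i * w i ^ (stair n j)).det =
      (Matrix.projVandermonde v w).det := by
  -- The column operations expressing the forms in monomials: a unitriangular matrix, since the
  -- forms are monic.
  set U : Matrix (Fin n) (Fin n) A := Matrix.of fun m j => if m ≤ j then c j m else 0 with hU
  have h1 : (Matrix.of fun i j : Fin n => f j i * w i ^ (stair n j)) =
      Matrix.projVandermonde v w * U := by
    ext i j
    rw [Matrix.mul_apply]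
    simp only [Matrix.of_apply, hU, Matrix.projVandermonde_apply, mul_ite, mul_zero]
    rw [hf, Finset.sum_mul, ← Finset.sum_filter]
    refine (Finset.sum_bij (fun (m : Fin n) _ => (m : ℕ)) ?_ ?_ ?_ ?_).symm
    · intro m hm
      simp only [Finset.mem_filter, Finset.mem_univ, true_and, Fin.le_def] at hm
      simp only [Finset.mem_range]
      omega
    · intro a _ b _ hab
      exact Fin.ext hab
    · intro m hm
      simp only [Finset.mem_range] at hm
      refine ⟨⟨m, by omega⟩, ?_, rfl⟩
      simp only [Finset.mem_filter, Finset.mem_univ, true_and, Fin.le_def]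
      omega
    · intro m hm
      simp only [Finset.mem_filter, Finset.mem_univ, true_and, Fin.le_def] at hm
      have : (Fin.rev m : ℕ) = (j - m) + stair n j := by
        rw [stair_apply, Fin.val_rev]
        omega
      rw [this, pow_add]
      ring
  have h2 : U.det = 1 := by
    rw [Matrix.det_of_isUpperTriangular]
    · simp [hU, hc]
    · intro i j hij
      simp only [id] at hij
      simp [hU, hij.not_ge]
  rw [h1, Matrix.det_mul, h2, mul_one]

/-- The recurrence is Chebyshev's, with `v = 1 + t²` and `w = t` in the applications. It is assumed
only from index 3 on, and `f 2` is adjusted by `x`, because the symplectic family starts with `1`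
instead of `1 + t^0 = 2`: there `x = 2`, whereas `x = 1` for geometric sums. -/
theorem exists_monic_forms (v w : Fin n → A) (f : ℕ → Fin n → A) (h0 : ∀ i, f 0 i = 1)
    (h1 : ∀ i, f 1 i = v i) (x : A) (h2 : ∀ i, f 2 i = v i ^ 2 - x * w i ^ 2)
    (hrec : ∀ j i, f (j + 3) i = v i * f (j + 2) i - w i ^ 2 * f (j + 1) i) :
    ∃ c : ℕ → ℕ → A, (∀ j, c j j = 1) ∧
      ∀ j i, f j i = ∑ m ∈ Finset.range (j + 1), c j m * (v i ^ m * w i ^ (j - m)) := by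
  have key : ∀ j, ∃ c : ℕ → A, c j = 1 ∧
      ∀ i, f j i = ∑ m ∈ Finset.range (j + 1), c m * (v i ^ m * w i ^ (j - m)) := by
    have hstep : ∀ j, (∃ c : ℕ → A, c (j + 1) = 1 ∧
        ∀ i, f (j + 1) i = ∑ m ∈ Finset.range (j + 2), c m * (v i ^ m * w i ^ (j + 1 - m))) ∧
        ∃ c : ℕ → A, c (j + 2) = 1 ∧
        ∀ i, f (j + 2) i = ∑ m ∈ Finset.range (j + 3), c m * (v i ^ m * w i ^ (j + 2 - m)) := by
      intro j
      induction j with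
      | zero =>
        refine ⟨⟨fun m => if m = 1 then 1 else 0, rfl, fun i => ?_⟩,
          ⟨fun m => if m = 2 then 1 else if m = 0 then -x else 0, rfl, fun i => ?_⟩⟩
        · simp [h1]
        · simp [Finset.sum_range_succ, h2]
          ring
      | succ j ih =>
        obtain ⟨⟨c, hc, hfc⟩, d, hd, hfd⟩ := ih
        refine ⟨⟨d, hd, hfd⟩, fun m => (if m = 0 then 0 else d (m - 1)) -
          if m ≤ j + 1 then c m else 0, by simp [hd], fun i => ?_⟩
        rw [show j + 1 + 2 = j + 3 from rfl, hrec, hfd, hfc]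
        simp only [sub_mul, Finset.sum_sub_distrib]
        congr 1
        · rw [Finset.sum_range_succ' _ (j + 3), Finset.mul_sum]
          simp only [if_true, zero_mul, add_zero]
          refine Finset.sum_congr rfl fun m hm => ?_
          rw [if_neg (Nat.succ_ne_zero m), Nat.add_sub_cancel, pow_succ,
            show j + 1 + 2 - (m + 1) = j + 2 - m by omega]
          ring
        · rw [Finset.sum_range_succ _ (j + 3), Finset.sum_range_succ _ (j + 2), Finset.mul_sum]
          rw [if_neg (by omega), if_neg (by omega), zero_mul, zero_mul, add_zero, add_zero]
          refine Finset.sum_congr rfl fun m hm => ?_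
          rw [Finset.mem_range] at hm
          rw [if_pos (by omega), show j + 1 + 2 - m = (j + 1 - m) + 2 by omega, pow_add]
          ring
    intro j
    match j with
    | 0 => exact ⟨fun _ => 1, rfl, fun i => by simp [h0]⟩
    | j + 1 => exact (hstep j).1
  choose c hc using key
  exact ⟨c, fun j => (hc j).1, fun j => (hc j).2⟩

theorem det_sp_denominator (t : Fin n → A) :
    (Matrix.of fun i j : Fin n => if (j : ℕ) = 0 then t i ^ (stair n j) else
      t i ^ (stair n j) + t i ^ (stair n j + 2 * (j : ℕ))).det = vand t * ker 1 t := by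
  set f : ℕ → Fin n → A := fun j i => if j = 0 then 1 else 1 + t i ^ (2 * j) with hf
  obtain ⟨c, hc, hfc⟩ := exists_monic_forms (fun i => 1 + t i ^ 2) t f (fun i => by simp [hf])
    (fun i => by simp [hf]) 2 (fun i => by simp [hf]; ring) (fun j i => by
      simp [hf]; ring)
  rw [← mul_projVandermonde_one_add_sq, ← det_monic_forms _ _ f c hc hfc]
  congr 1
  ext i j
  simp only [Matrix.of_apply, hf]
  split_ifs
  · rw [one_mul]
  · rw [pow_add]
    ring

/-- Row `i` is divisible by `1 - t_i²`. What remains in column `j` is a geometric sum in `t_i²`, a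
monic form in `1 + t_i²` and `t_i`. -/
theorem det_so_denominator (t : Fin n → A) :
    (Matrix.of fun i j : Fin n => t i ^ (stair n j) -
      t i ^ (stair n j + 2 * (j : ℕ) + 2)).det = vand t * (ker 1 t * kerDiag 1 t) := by
  set f : ℕ → Fin n → A := fun j i => ∑ m ∈ Finset.range (j + 1), (t i ^ 2) ^ m with hf
  obtain ⟨c, hc, hfc⟩ := exists_monic_forms (fun i => 1 + t i ^ 2) t f (fun i => by simp [hf])
    (fun i => by simp [hf, Finset.sum_range_succ]) 1
    (fun i => by simp [hf, Finset.sum_range_succ]; ring) (fun j i => by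
      simp only [hf, Finset.sum_range_succ _ (j + 3), Finset.sum_range_succ _ (j + 2)]
      ring)
  rw [← mul_assoc, ← mul_projVandermonde_one_add_sq, ← det_monic_forms _ _ f c hc hfc, mul_comm,
    kerDiag, ← Matrix.det_mul_column]
  congr 1
  ext i j
  simp only [Matrix.of_apply, hf]
  have := mul_neg_geom_sum (t i ^ 2) (j + 1)
  rw [← mul_assoc, one_mul, ← pow_two, this, ← pow_mul]
  ring

end WeylDenominators

/-! ### Jacobi-Trudi: alternants as Vandermonde times `schur`. -/

section Bialternants

variable {A : Type*} [CommRing A] {n : ℕ}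

/-- The generating series `∏ 1 / (1 - t_i X)` of the complete homogeneous symmetric polynomials. -/
noncomputable def hSeries (t : Fin n → A) : PowerSeries A :=
  PowerSeries.invOfUnit (∏ i, (1 - PowerSeries.C (t i) * PowerSeries.X)) 1

theorem hSeries_mul (t : Fin n → A) :
    hSeries t * ∏ i, (1 - PowerSeries.C (t i) * PowerSeries.X) = 1 := by
  rw [mul_comm]
  refine PowerSeries.mul_invOfUnit _ _ ?_
  simp [map_prod]

/-- The coefficients of a power series, extended by zero to negative indices. -/
noncomputable def intCoeff (u : PowerSeries A) (r : ℤ) : A :=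
  if 0 ≤ r then PowerSeries.coeff r.toNat u else 0

theorem intCoeff_natCast (u : PowerSeries A) (r : ℕ) : intCoeff u r = PowerSeries.coeff r u := by
  simp [intCoeff]

theorem intCoeff_of_neg (u : PowerSeries A) {r : ℤ} (hr : r < 0) : intCoeff u r = 0 :=
  if_neg (by omega)

/-- The complete homogeneous symmetric polynomial in the variables `t`. -/
noncomputable def hPoly (t : Fin n → A) (r : ℤ) : A := intCoeff (hSeries t) r

theorem hPoly_zero (t : Fin n → A) : hPoly t 0 = 1 := by
  simp [hPoly, intCoeff, hSeries, PowerSeries.coeff_invOfUnit]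

theorem hPoly_of_neg (t : Fin n → A) {r : ℤ} (hr : r < 0) : hPoly t r = 0 := intCoeff_of_neg _ hr

/-- The product `∏_{i ≠ k} (1 - t_i X)`. -/
noncomputable def elemPoly (t : Fin n → A) (k : Fin n) : Polynomial A :=
  ∏ i ∈ Finset.univ.erase k, (1 - Polynomial.C (t i) * Polynomial.X)

theorem natDegree_elemPoly (t : Fin n → A) (k : Fin n) : (elemPoly t k).natDegree < n := by
  have h1 : (elemPoly t k).natDegree ≤ (Finset.univ.erase k).card • 1 := by
    refine (Polynomial.natDegree_prod_le _ _).trans ?_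
    rw [← Finset.sum_const]
    refine Finset.sum_le_sum fun i _ => ?_
    refine (Polynomial.natDegree_sub_le _ _).trans ?_
    simpa using (Polynomial.natDegree_C_mul_le (t i) Polynomial.X).trans Polynomial.natDegree_X_le
  have := k.pos
  rw [Finset.card_erase_of_mem (Finset.mem_univ k), Finset.card_univ, Fintype.card_fin] at h1
  simp only [smul_eq_mul, mul_one] at h1
  omega

theorem hSeries_mul_elemPoly (t : Fin n → A) (k : Fin n) :
    hSeries t * (elemPoly t k : PowerSeries A) = PowerSeries.mk fun r => t k ^ r := by
  have h1 : (PowerSeries.mk fun r => t k ^ r) * (1 - PowerSeries.C (t k) * PowerSeries.X) = 1 := by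
    have := PowerSeries.mk_one_mul_one_sub_eq_one A
    have h := congrArg (PowerSeries.rescale (t k)) this
    simpa [PowerSeries.rescale_mk] using h
  have h2 : (elemPoly t k : PowerSeries A) * (1 - PowerSeries.C (t k) * PowerSeries.X) =
      ∏ i, (1 - PowerSeries.C (t i) * PowerSeries.X) := by
    rw [← Finset.prod_erase_mul _ _ (Finset.mem_univ k), elemPoly]
    congr 1
    rw [← Polynomial.coeToPowerSeries.ringHom_apply, map_prod]
    simp
  have h3 := hSeries_mul t
  rw [← h2] at h3
  calc _ = hSeries t * (elemPoly t k : PowerSeries A) * ((PowerSeries.mk fun r => t k ^ r) *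
        (1 - PowerSeries.C (t k) * PowerSeries.X)) := by rw [h1, mul_one]
    _ = (PowerSeries.mk fun r => t k ^ r) * (hSeries t * ((elemPoly t k : PowerSeries A) *
        (1 - PowerSeries.C (t k) * PowerSeries.X))) := by ring
    _ = _ := by rw [h3, mul_one]

/-- Compare coefficients of `X^a` in `H(X) ∏_{i≠k} (1 - t_i X) = 1 / (1 - t_k X)`; the product has
degree below `n`, so `n` terms suffice. -/
theorem pow_eq_sum_hPoly (t : Fin n → A) (k : Fin n) (a : ℕ) :
    t k ^ a = ∑ j : Fin n, (elemPoly t k).coeff (stair n j) * hPoly t ((a : ℤ) - stair n j) := by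
  have h1 := congrArg (PowerSeries.coeff a) (hSeries_mul_elemPoly t k)
  rw [PowerSeries.coeff_mk, mul_comm, PowerSeries.coeff_mul,
    Finset.Nat.sum_antidiagonal_eq_sum_range_succ_mk] at h1
  rw [← h1]
  simp only [Polynomial.coeff_coe]
  have h2 : ∑ j : Fin n, (elemPoly t k).coeff (stair n j) * hPoly t ((a : ℤ) - stair n j) =
      ∑ m ∈ Finset.range n, (elemPoly t k).coeff m * hPoly t ((a : ℤ) - m) := by
    rw [← Fin.sum_univ_eq_sum_range]
    exact Equiv.sum_comp Fin.revPerm fun j : Fin n =>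
      (elemPoly t k).coeff j * hPoly t ((a : ℤ) - (j : ℕ))
  -- The larger range contains both truncations: `m < n` from the degree of `elemPoly`, and `m ≤ a`
  -- from the vanishing of `hPoly` at negative indices.
  have h3 : ∑ m ∈ Finset.range n, (elemPoly t k).coeff m * hPoly t ((a : ℤ) - m) =
      ∑ m ∈ Finset.range (n + (a + 1)), (elemPoly t k).coeff m * hPoly t ((a : ℤ) - m) := by
    refine Finset.sum_subset (Finset.range_mono (by omega)) fun m _ hm => ?_
    rw [Finset.mem_range] at hm
    have := natDegree_elemPoly t k
    rw [Polynomial.coeff_eq_zero_of_natDegree_lt (by omega), zero_mul]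
  rw [h2, h3]
  symm
  refine (Finset.sum_subset (Finset.range_mono (by omega)) fun m _ hm => ?_).symm.trans
    (Finset.sum_congr rfl fun m hm => ?_)
  · rw [Finset.mem_range] at hm
    rw [hPoly_of_neg _ (by omega), mul_zero]
  · rw [Finset.mem_range] at hm
    rw [hPoly, ← Nat.cast_sub (by omega), intCoeff_natCast]

/-- The Jacobi-Trudi determinant of `λ` in the variables `t`. -/
noncomputable def schur (t : Fin n → A) (l : Fin n → ℕ) : A :=
  Matrix.det (Matrix.of fun i j : Fin n => hPoly t ((l i : ℤ) - (i : ℤ) + (j : ℤ)))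

/-- The matrix of the alternant is `M` times the transposed Jacobi-Trudi matrix, with `M`
independent of `l`. Taking `l = 0`, where the Jacobi-Trudi matrix is unitriangular, identifies `det
M` with the Vandermonde determinant. -/
theorem alt_add_stair (t : Fin n → A) (l : Fin n → ℕ) :
    alt t (fun i => l i + stair n i) = vand t * schur t l := by
  set M : Matrix (Fin n) (Fin n) A := Matrix.of fun k j => (elemPoly t k).coeff (stair n j) with hM
  have h1 : ∀ l : Fin n → ℕ, alt t (fun i => l i + stair n i) = M.det * schur t l := by
    intro l
    rw [schur, ← Matrix.det_transpose (Matrix.of fun i j : Fin n => hPoly t _), ← Matrix.det_mul,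
      alt]
    congr 1
    ext k i
    rw [Matrix.of_apply, pow_eq_sum_hPoly, Matrix.mul_apply]
    refine Finset.sum_congr rfl fun j _ => ?_
    rw [Matrix.transpose_apply, Matrix.of_apply, hM, Matrix.of_apply]
    congr 2
    have := i.is_lt
    have := j.is_lt
    rw [stair_apply, stair_apply]
    omega
  have h2 : schur t (fun _ => 0) = 1 := by
    rw [schur, Matrix.det_of_isUpperTriangular]
    · simp [hPoly_zero]
    · intro i j hij
      simp only [id, Fin.lt_def] at hij
      rw [Matrix.of_apply, hPoly_of_neg]
      push_cast
      omega
  have h3 := h1 fun _ => 0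
  rw [h2, mul_one] at h3
  simp only [zero_add] at h3
  rw [h1, ← h3, vand]

end Bialternants

/-! ### Littlewood's identities in `n` variables. -/

section Littlewood

variable {A : Type*} [CommRing A] {n : ℕ}

open Classical in
/-- The partitions of `d` with at most `n` parts, as antitone functions on `Fin n`. -/
noncomputable def antiFuns (n d : ℕ) : Finset (Fin n → ℕ) :=
  {f ∈ Finset.piAntidiag Finset.univ d | Antitone f}

theorem mem_antiFuns {d : ℕ} {f : Fin n → ℕ} :
    f ∈ antiFuns n d ↔ ∑ i, f i = d ∧ Antitone f := by
  simp [antiFuns]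

/-- All parts are even. -/
def EvenParts (f : Fin n → ℕ) : Prop := ∀ i, Even (f i)

/-- All parts of the conjugate partition are even. -/
def EvenConj (f : Fin n → ℕ) : Prop := ∀ j, Even (Finset.card {i | j < f i})

open Classical in
/-- The sum of the alternants `a_{f + δ}` over the partitions `f` of `d` with the property `P`. -/
noncomputable def altSum (t : Fin n → A) (P : (Fin n → ℕ) → Prop) (d : ℕ) : A :=
  ∑ f ∈ antiFuns n d with P f, alt t (fun i => f i + stair n i)

/-- Partitions are split by their last part. If it is zero, the alternant expands into alternants in
`n` variables; if not, `s` columns of full height `n + 1` are removed, which costs `2 m` boxes. The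
proposition `ok` records whether such columns are allowed: `s = 2` and always for even rows, `s = 1`
and `n` odd for even columns. -/
theorem altSum_succ (t : Fin (n + 1) → A) (P : (Fin (n + 1) → ℕ) → Prop)
    (P' : (Fin n → ℕ) → Prop) (s m : ℕ) (ok : Prop) [Decidable ok] (hm : ok → s * (n + 1) = 2 * m)
    (hz : ∀ f : Fin (n + 1) → ℕ, f (Fin.last n) = 0 → (P f ↔ P' fun i => f i.castSucc))
    (hs : ∀ f : Fin (n + 1) → ℕ, ok → (P (fun i => f i + s) ↔ P f))
    (hp : ∀ f : Fin (n + 1) → ℕ, Antitone f → f (Fin.last n) ≠ 0 → P f → ok ∧ s ≤ f (Fin.last n))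
    (hs0 : s ≠ 0) (k : ℕ) :
    altSum t P (2 * k) = ∑ j : Fin (n + 1), (-1) ^ ((j : ℕ) + n) * ((∏ i, t (j.succAbove i)) *
      altSum (fun i => t (j.succAbove i)) P' (2 * k)) +
      if ok ∧ m ≤ k then (∏ i, t i) ^ s * altSum t P (2 * (k - m)) else 0 := by
  classical
  rw [altSum, ← Finset.sum_filter_add_sum_filter_not _ fun f => f (Fin.last n) = 0]
  congr 1
  · simp_rw [altSum, Finset.mul_sum]
    rw [Finset.sum_comm]
    refine Finset.sum_bij' (fun f _ i => f i.castSucc)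
      (fun f _ => Fin.snoc (α := fun _ => ℕ) f 0) ?_ ?_ ?_ ?_ ?_
    · intro f hf
      simp only [Finset.mem_filter, mem_antiFuns] at hf ⊢
      obtain ⟨⟨⟨h1, h2⟩, h3⟩, h4⟩ := hf
      rw [Fin.sum_univ_castSucc, h4, add_zero] at h1
      exact ⟨⟨h1, fun i j hij => h2 (Fin.castSucc_le_castSucc_iff.2 hij)⟩, (hz f h4).1 h3⟩
    · intro f hf
      simp only [Finset.mem_filter, mem_antiFuns] at hf ⊢
      obtain ⟨⟨h1, h2⟩, h3⟩ := hf
      refine ⟨⟨⟨?_, ?_⟩, ?_⟩, ?_⟩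
      · simp [Fin.sum_univ_castSucc, h1]
      · intro i j hij
        induction j using Fin.lastCases with
        | last => simp
        | cast j =>
          induction i using Fin.lastCases with
          | last => exact absurd hij (by simp [Fin.le_def])
          | cast i => simpa using h2 (Fin.castSucc_le_castSucc_iff.1 hij)
      · rw [hz _ (by simp)]
        simpa using h3
      · simp
    · intro f hf
      simp only [Finset.mem_filter] at hf
      ext i
      induction i using Fin.lastCases with
      | last => simp [hf.2]
      | cast i => simp
    · intro f _
      ext i
      simp
    · intro f hf
      simp only [Finset.mem_filter] at hf
      rw [alt_snoc_zero t _ fun i => f i.castSucc + stair n i]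
      · simp [hf.2, stair_apply]
      · intro i
        have := i.is_lt
        simp only [stair_apply, Fin.val_castSucc]
        omega
  · have hsum : ∀ f : Fin (n + 1) → ℕ, ∑ i, (f i + s) = ∑ i, f i + s * (n + 1) := fun f => by
      simp [Finset.sum_add_distrib, mul_comm]
    split_ifs with hok
    · rw [altSum, Finset.mul_sum]
      have hm' := hm hok.1
      have hsub : ∀ f : Fin (n + 1) → ℕ, Antitone f → f (Fin.last n) ≠ 0 → P f →
          (fun i => f i - s + s) = f := fun f h2 h4 h3 => by
        ext i
        have := (hp f h2 h4 h3).2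
        have := h2 (Fin.le_last i)
        omega
      refine Finset.sum_bij' (fun f _ i => f i - s) (fun f _ i => f i + s) ?_ ?_ ?_ ?_ ?_
      · intro f hf
        simp only [Finset.mem_filter, mem_antiFuns] at hf ⊢
        obtain ⟨⟨⟨h1, h2⟩, h3⟩, h4⟩ := hf
        have h5 := hsub f h2 h4 h3
        have h6 := hsum fun i => f i - s
        refine ⟨⟨?_, fun i j hij => Nat.sub_le_sub_right (h2 hij) _⟩, ?_⟩
        · have h7 : ∑ i, (f i - s + s) = ∑ i, f i := Finset.sum_congr rfl fun i _ => congrFun h5 i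
          omega
        · rw [← hs _ hok.1, h5]
          exact h3
      · intro f hf
        simp only [Finset.mem_filter, mem_antiFuns] at hf ⊢
        obtain ⟨⟨h1, h2⟩, h3⟩ := hf
        have h6 := hsum f
        refine ⟨⟨⟨by omega, fun i j hij => Nat.add_le_add_right (h2 hij) _⟩, ?_⟩, by omega⟩
        rwa [hs _ hok.1]
      · intro f hf
        simp only [Finset.mem_filter, mem_antiFuns] at hf
        exact hsub f hf.1.1.2 hf.2 hf.1.2
      · intro f hf
        simp
      · intro f hf
        simp only [Finset.mem_filter, mem_antiFuns] at hf
        have h5 := hsub f hf.1.1.2 hf.2 hf.1.2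
        rw [← alt_add_const]
        congr 1
        ext i
        have h6 : f i - s + s = f i := congrFun h5 i
        change f i + stair (n + 1) i = f i - s + stair (n + 1) i + s
        omega
    · refine Finset.sum_eq_zero fun f hf => absurd ?_ hok
      simp only [Finset.mem_filter, mem_antiFuns] at hf
      obtain ⟨⟨⟨h1, h2⟩, h3⟩, h4⟩ := hf
      obtain ⟨h5, h6⟩ := hp f h2 h4 h3
      refine ⟨h5, ?_⟩
      have h7 : ∑ i : Fin (n + 1), s ≤ ∑ i, f i :=
        Finset.sum_le_sum fun i _ => h6.trans (h2 (Fin.le_last i))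
      have := hm h5
      simp only [Finset.sum_const, Finset.card_univ, Fintype.card_fin, smul_eq_mul] at h7
      rw [mul_comm] at h7
      omega

/-- The generating series of `altSum`, where a partition of `2 k` has weight `q ^ k`. -/
noncomputable def altSeries (t : Fin n → A) (P : (Fin n → ℕ) → Prop) : PowerSeries A :=
  PowerSeries.mk fun k => altSum t P (2 * k)

theorem altSeries_succ (t : Fin (n + 1) → A) (P : (Fin (n + 1) → ℕ) → Prop)
    (P' : (Fin n → ℕ) → Prop) (s m : ℕ) (ok : Prop) [Decidable ok] (hm : ok → s * (n + 1) = 2 * m)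
    (hz : ∀ f : Fin (n + 1) → ℕ, f (Fin.last n) = 0 → (P f ↔ P' fun i => f i.castSucc))
    (hs : ∀ f : Fin (n + 1) → ℕ, ok → (P (fun i => f i + s) ↔ P f))
    (hp : ∀ f : Fin (n + 1) → ℕ, Antitone f → f (Fin.last n) ≠ 0 → P f → ok ∧ s ≤ f (Fin.last n))
    (hs0 : s ≠ 0) :
    (1 - if ok then PowerSeries.X ^ m * PowerSeries.C (∏ i, t i) ^ s else 0) * altSeries t P =
      ∑ j : Fin (n + 1), (-1) ^ ((j : ℕ) + n) * (PowerSeries.C (∏ i, t (j.succAbove i)) *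
        altSeries (fun i => t (j.succAbove i)) P') := by
  have key : altSeries t P = ∑ j : Fin (n + 1), (-1) ^ ((j : ℕ) + n) *
      (PowerSeries.C (∏ i, t (j.succAbove i)) * altSeries (fun i => t (j.succAbove i)) P') +
      (if ok then PowerSeries.X ^ m * PowerSeries.C (∏ i, t i) ^ s else 0) * altSeries t P := by
    ext k
    have h1 : ∀ j : Fin (n + 1), (-1 : PowerSeries A) ^ ((j : ℕ) + n) =
        PowerSeries.C ((-1) ^ ((j : ℕ) + n)) := fun j => by simp
    rw [map_add, map_sum, altSeries, PowerSeries.coeff_mk,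
      altSum_succ t P P' s m ok hm hz hs hp hs0 k]
    simp_rw [h1, PowerSeries.coeff_C_mul]
    congr 1
    · simp [altSeries]
    · split_ifs with h h' h'
      · rw [mul_assoc, PowerSeries.coeff_X_pow_mul', if_pos h.2, ← map_pow,
          PowerSeries.coeff_C_mul, PowerSeries.coeff_mk]
      · exact absurd h.1 h'
      · rw [mul_assoc, PowerSeries.coeff_X_pow_mul', if_neg fun h'' => h ⟨h', h''⟩]
      · simp
  rw [sub_mul, one_mul, sub_eq_iff_eq_add, ← key]

theorem isUnit_one_sub_X_pow_mul {m : ℕ} (hm : m ≠ 0) (a : PowerSeries A) :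
    IsUnit (1 - PowerSeries.X ^ m * a) := by
  rw [PowerSeries.isUnit_iff_constantCoeff]
  simp [hm]

theorem vand_map {B : Type*} [CommRing B] (φ : A →+* B) (t : Fin n → A) :
    vand (fun i => φ (t i)) = φ (vand t) := by
  rw [vand, vand, alt, alt, RingHom.map_det]
  congr 1
  ext i j
  simp

theorem vand_C (t : Fin n → A) :
    vand (fun i => PowerSeries.C (t i)) = PowerSeries.C (vand t) :=
  vand_map PowerSeries.C t

theorem altSeries_zero (t : Fin 0 → A) (P : (Fin 0 → ℕ) → Prop) (hP : ∀ f, P f) :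
    altSeries t P = 1 := by
  classical
  ext k
  rw [altSeries, PowerSeries.coeff_mk, altSum, PowerSeries.coeff_one]
  have : ({f ∈ antiFuns 0 (2 * k) | P f} : Finset (Fin 0 → ℕ)) =
      if k = 0 then {Fin.elim0} else ∅ := by
    ext f
    rw [Finset.mem_filter, mem_antiFuns]
    split_ifs with h
    · simp [h, hP, Subsingleton.elim f Fin.elim0, show Antitone (Fin.elim0 : Fin 0 → ℕ) from
        fun i => i.elim0]
    · simp [eq_comm, h]
  rw [this]
  split_ifs <;> simp [alt]

/-- In the recursion `altSeries_succ`, the kernel in `n + 1` variables splits for each `j` into the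
kernel without `t_j`, absorbed by induction, and the factors involving `t_j`, summed by
`sum_ker_diag_identity`. -/
theorem evenParts_altSeries (n : ℕ) (t : Fin n → A) :
    ker PowerSeries.X (fun i => PowerSeries.C (t i)) *
      kerDiag PowerSeries.X (fun i => PowerSeries.C (t i)) * altSeries t EvenParts =
        PowerSeries.C (vand t) := by
  induction n with
  | zero =>
    rw [altSeries_zero t EvenParts fun f (i : Fin 0) => i.elim0]
    simp [ker, kerDiag, pairProd, vand, alt]
  | succ n ih =>
    have h1 := altSeries_succ t EvenParts EvenParts 2 (n + 1) True (fun _ => rfl)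
      (fun f hf => by
        rw [EvenParts, Fin.forall_fin_succ', hf]
        simp [EvenParts])
      (fun f _ => by simp [EvenParts, Nat.even_add])
      (fun f _ hf h => by
        obtain ⟨a, ha⟩ := h (Fin.last n)
        exact ⟨trivial, by omega⟩) two_ne_zero
    rw [if_pos trivial] at h1
    have h2 := sum_ker_diag_identity PowerSeries.X fun i => PowerSeries.C (t i)
    -- The factor created by stripping two full columns is a unit because `q` is a formal variable.
    refine (isUnit_one_sub_X_pow_mul n.succ_ne_zero (PowerSeries.C (∏ i, t i) ^ 2)).mul_left_cancel
      ?_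
    rw [mul_left_comm, h1, ← vand_C, map_prod, ← h2, Finset.mul_sum]
    refine Finset.sum_congr rfl fun j _ => ?_
    rw [ker_succAbove _ _ j, kerDiag_succAbove _ _ j, vand_C,
      ← ih fun i => t (j.succAbove i), map_prod]
    ring

/-- The same induction with `sum_ker_identity`; the parity of `n` there matches whether a full
column of length `n + 1` is even. -/
theorem evenConj_altSeries (n : ℕ) (t : Fin n → A) :
    ker PowerSeries.X (fun i => PowerSeries.C (t i)) * altSeries t EvenConj =
        PowerSeries.C (vand t) := by
  classical
  induction n with
  | zero =>
    rw [altSeries_zero t EvenConj fun f i => by simp [Finset.univ_eq_empty]]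
    simp [ker, pairProd, vand, alt]
  | succ n ih =>
    have h1 := altSeries_succ t EvenConj EvenConj 1 ((n + 1) / 2) (Odd n)
      (fun h => by
        obtain ⟨a, ha⟩ := h
        omega)
      (fun f hf => by
        refine forall_congr' fun j => ?_
        rw [Finset.card_filter, Fin.sum_univ_castSucc, hf, Finset.card_filter]
        simp)
      (fun f h => by
        refine ⟨fun h' j => ?_, fun h' j => ?_⟩
        · simpa using h' (j + 1)
        · cases j with
          | zero => simpa using h.add_one
          | succ j => simpa using h' j)
      (fun f hf hf0 h => by
        refine ⟨?_, by omega⟩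
        -- A nonzero last part gives the first column full length `n + 1`, so its evenness forces
        -- `n` to be odd.
        have h0 := h 0
        have : (Finset.univ.filter fun i => 0 < f i) = Finset.univ :=
          Finset.filter_true_of_mem fun i _ => lt_of_lt_of_le (Nat.pos_of_ne_zero hf0)
            (hf (Fin.le_last i))
        rw [this, Finset.card_univ, Fintype.card_fin, Nat.even_add_one,
          Nat.not_even_iff_odd] at h0
        exact h0) one_ne_zero
    have h2 := sum_ker_identity PowerSeries.X fun i => PowerSeries.C (t i)
    have hu : IsUnit (1 - if Odd n then
        (PowerSeries.X : PowerSeries A) ^ ((n + 1) / 2) * PowerSeries.C (∏ i, t i) ^ 1 else 0) := by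
      split_ifs with h
      · obtain ⟨a, ha⟩ := h
        exact isUnit_one_sub_X_pow_mul (by omega) _
      · simp
    refine hu.mul_left_cancel ?_
    rw [mul_left_comm, h1, ← vand_C, map_prod, pow_one, ← h2, Finset.mul_sum]
    refine Finset.sum_congr rfl fun j _ => ?_
    rw [ker_succAbove _ _ j, vand_C, ← ih fun i => t (j.succAbove i), map_prod]
    ring

end Littlewood

/-! ### Young diagrams with at most `n` rows as functions on `Fin n`. -/

section Diagrams

/-- The first `n` parts of a partition. -/
def rowFun (n : ℕ) (μ : YoungDiagram) : Fin n → ℕ := fun i => μ.rowLen i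

theorem antitone_rowFun (n : ℕ) (μ : YoungDiagram) : Antitone (rowFun n μ) :=
  fun i j hij => μ.rowLen_anti i j hij

theorem rowLen_eq_zero {μ : YoungDiagram} {i : ℕ} (hi : μ.colLen 0 ≤ i) : μ.rowLen i = 0 := by
  by_contra h
  have : (i, 0) ∈ μ := YoungDiagram.mem_iff_lt_rowLen.2 (Nat.pos_of_ne_zero h)
  rw [YoungDiagram.mem_iff_lt_colLen] at this
  omega

theorem colLen_eq_card_rowFun {n : ℕ} {μ : YoungDiagram} (hμ : μ.colLen 0 ≤ n) (j : ℕ) :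
    μ.colLen j = Finset.card {i | j < rowFun n μ i} := by
  rw [← Finset.card_range (μ.colLen j)]
  refine Finset.card_bij' (fun i hi => (⟨i, ?_⟩ : Fin n)) (fun i _ => (i : ℕ)) ?_ ?_ ?_ ?_
  · rw [Finset.mem_range] at hi
    have := μ.colLen_anti 0 j (Nat.zero_le j)
    omega
  · intro i hi
    rw [Finset.mem_range, ← YoungDiagram.mem_iff_lt_colLen, YoungDiagram.mem_iff_lt_rowLen] at hi
    exact Finset.mem_filter.2 ⟨Finset.mem_univ _, hi⟩
  · intro i hi
    rw [Finset.mem_range, ← YoungDiagram.mem_iff_lt_colLen, YoungDiagram.mem_iff_lt_rowLen]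
    exact (Finset.mem_filter.1 hi).2
  · intro i _
    rfl
  · intro i _
    rfl

theorem sum_rowFun {n : ℕ} {μ : YoungDiagram} (hμ : μ.colLen 0 ≤ n) :
    ∑ i, rowFun n μ i = μ.card := by
  rw [YoungDiagram.card, Finset.card_eq_sum_card_fiberwise (f := Prod.fst)
    (t := Finset.range n)]
  · rw [← Fin.sum_univ_eq_sum_range]
    refine Finset.sum_congr rfl fun i _ => ?_
    rw [rowFun, YoungDiagram.rowLen_eq_card]
    rfl
  · intro c hc
    have hc' : (c.1, c.2) ∈ μ := hc
    have : (c.1, 0) ∈ μ := μ.up_left_mem le_rfl (Nat.zero_le _) hc'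
    rw [YoungDiagram.mem_iff_lt_colLen] at this
    simp only [Finset.coe_range, Set.mem_Iio]
    omega

theorem colLen_le_card (μ : YoungDiagram) : μ.colLen 0 ≤ μ.card := by
  rw [YoungDiagram.colLen_eq_card]
  exact Finset.card_le_card (Finset.filter_subset _ _)

theorem rowFun_injective {n : ℕ} {μ ν : YoungDiagram} (hμ : μ.colLen 0 ≤ n) (hν : ν.colLen 0 ≤ n)
    (h : rowFun n μ = rowFun n ν) : μ = ν := by
  have hrow : ∀ i, μ.rowLen i = ν.rowLen i := fun i => by
    by_cases hi : i < n
    · exact congrFun h ⟨i, hi⟩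
    · rw [rowLen_eq_zero (by omega), rowLen_eq_zero (by omega)]
  refine SetLike.ext fun c => ?_
  obtain ⟨i, j⟩ := c
  rw [YoungDiagram.mem_iff_lt_rowLen, YoungDiagram.mem_iff_lt_rowLen, hrow]

theorem exists_rowFun_eq {n : ℕ} {f : Fin n → ℕ} (hf : Antitone f) :
    ∃ μ : YoungDiagram, μ.colLen 0 ≤ n ∧ rowFun n μ = f := by
  have hw : (List.ofFn f).SortedGE := by
    rwa [List.sortedGE_ofFn_iff]
  refine ⟨YoungDiagram.ofRowLens (List.ofFn f) hw, ?_, ?_⟩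
  · by_contra h
    have h1 : (n, 0) ∈ YoungDiagram.ofRowLens (List.ofFn f) hw :=
      YoungDiagram.mem_iff_lt_colLen.2 (by omega)
    rw [YoungDiagram.mem_ofRowLens] at h1
    obtain ⟨h1, -⟩ := h1
    simp at h1
  · ext i
    have := YoungDiagram.rowLen_ofRowLens (hw := hw) ⟨i, by simp⟩
    simpa [rowFun] using this

theorem mem_evenRows_iff {n : ℕ} {μ : YoungDiagram} (hμ : μ.colLen 0 ≤ n) :
    μ ∈ evenRows ↔ EvenParts (rowFun n μ) := by
  refine ⟨fun h i => h i, fun h i => ?_⟩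
  by_cases hi : i < n
  · exact h ⟨i, hi⟩
  · rw [rowLen_eq_zero (by omega)]
    exact Even.zero

theorem mem_evenCols_iff {n : ℕ} {μ : YoungDiagram} (hμ : μ.colLen 0 ≤ n) :
    μ ∈ evenCols ↔ EvenConj (rowFun n μ) :=
  forall_congr' fun j => by rw [colLen_eq_card_rowFun hμ]

theorem finite_card_eq (d : ℕ) : {μ : YoungDiagram | μ.card = d}.Finite := by
  refine Set.Finite.of_finite_image (f := rowFun d) ?_ fun μ hμ ν hν h => ?_
  · refine (antiFuns d d).finite_toSet.subset ?_
    rintro _ ⟨μ, hμ, rfl⟩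
    rw [Set.mem_ofPred_eq] at hμ
    rw [Finset.mem_coe, mem_antiFuns]
    exact ⟨(sum_rowFun (hμ ▸ colLen_le_card μ)).trans hμ, antitone_rowFun _ _⟩
  · rw [Set.mem_ofPred_eq] at hμ hν
    exact rowFun_injective (hμ ▸ colLen_le_card μ) (hν ▸ colLen_le_card ν) h

/-- The partitions of `d`. -/
noncomputable def parts (d : ℕ) : Finset YoungDiagram := (finite_card_eq d).toFinset

theorem mem_parts {d : ℕ} {μ : YoungDiagram} : μ ∈ parts d ↔ μ.card = d := by simp [parts]

theorem colLen_le_of_mem_parts {n d : ℕ} (hd : d ≤ n) {μ : YoungDiagram} (hμ : μ ∈ parts d) :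
    μ.colLen 0 ≤ n :=
  (colLen_le_card μ).trans ((mem_parts.1 hμ).trans_le hd)

open Classical in
theorem sum_parts {B : Type*} [AddCommMonoid B] {n d : ℕ} (hd : d ≤ n) (Q : Set YoungDiagram)
    (P : (Fin n → ℕ) → Prop)
    (hQ : ∀ μ : YoungDiagram, μ.colLen 0 ≤ n → (μ ∈ Q ↔ P (rowFun n μ))) (F : (Fin n → ℕ) → B) :
    ∑ μ ∈ parts d with μ ∈ Q, F (rowFun n μ) = ∑ f ∈ antiFuns n d with P f, F f := by
  refine Finset.sum_bij (fun μ _ => rowFun n μ) ?_ ?_ ?_ fun _ _ => rfl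
  · intro μ hμ
    rw [Finset.mem_filter] at hμ ⊢
    have h := colLen_le_of_mem_parts hd hμ.1
    exact ⟨mem_antiFuns.2 ⟨(sum_rowFun h).trans (mem_parts.1 hμ.1), antitone_rowFun _ _⟩,
      (hQ μ h).1 hμ.2⟩
  · intro μ hμ ν hν h
    rw [Finset.mem_filter] at hμ hν
    exact rowFun_injective (colLen_le_of_mem_parts hd hμ.1) (colLen_le_of_mem_parts hd hν.1) h
  · intro f hf
    rw [Finset.mem_filter, mem_antiFuns] at hf
    obtain ⟨μ, hμ, rfl⟩ := exists_rowFun_eq hf.1.2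
    exact ⟨μ, Finset.mem_filter.2 ⟨mem_parts.2 ((sum_rowFun hμ).symm.trans hf.1.1),
      (hQ μ hμ).2 hf.2⟩, rfl⟩

/-- The strictly decreasing exponents `λ + δ`. -/
def expo (n : ℕ) (μ : YoungDiagram) : Fin n → ℕ := fun i => rowFun n μ i + stair n i

theorem strictAnti_expo (n : ℕ) (μ : YoungDiagram) : StrictAnti (expo n μ) := fun i j hij => by
  have h1 := antitone_rowFun n μ hij.le
  have h2 : stair n j < stair n i := by
    have := j.is_lt
    rw [Fin.lt_def] at hij
    rw [stair_apply, stair_apply]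
    omega
  exact Nat.add_lt_add_of_le_of_lt h1 h2

theorem expo_injective {n : ℕ} {μ ν : YoungDiagram} (hμ : μ.colLen 0 ≤ n) (hν : ν.colLen 0 ≤ n)
    (h : expo n μ = expo n ν) : μ = ν :=
  rowFun_injective hμ hν (funext fun i => Nat.add_right_cancel (congrFun h i))

theorem exists_expo_eq {n : ℕ} {m : Fin n → ℕ} (hm : StrictAnti m) :
    ∃ μ : YoungDiagram, μ.colLen 0 ≤ n ∧ expo n μ = m := by
  -- Induction on `stair n i`, that is from the last index backwards: each step towards the front
  -- raises `m` by at least one.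
  have key : ∀ k (i : Fin n), stair n i = k → k ≤ m i ∧
      ∀ j, i ≤ j → m j + (stair n i - stair n j) ≤ m i := by
    intro k
    induction k with
    | zero =>
      intro i hi
      refine ⟨Nat.zero_le _, fun j hij => ?_⟩
      have := hm.antitone hij
      omega
    | succ k ih =>
      intro i hi
      have hi' := i.is_lt
      rw [stair_apply] at hi
      set i' : Fin n := ⟨i + 1, by omega⟩ with hi'
      have h1 : stair n i' = k := by
        rw [stair_apply]
        simp only [hi']
        omega
      have h2 : m i' < m i := hm (by simp [Fin.lt_def, hi'])
      obtain ⟨h3, h4⟩ := ih i' h1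
      refine ⟨by omega, fun j hij => ?_⟩
      rcases eq_or_lt_of_le hij with rfl | hij
      · omega
      · have h5 := h4 j (by rw [Fin.lt_def] at hij; simp [Fin.le_def, hi']; omega)
        rw [h1] at h5
        have h6 := stair_apply i
        omega
  obtain ⟨μ, hμ, h⟩ := exists_rowFun_eq (f := fun i => m i - stair n i) fun i j hij => by
    have h1 := (key _ i rfl).2 j hij
    have h2 := (key _ j rfl).1
    have h3 : stair n j ≤ stair n i := by
      rw [Fin.le_def] at hij
      rw [stair_apply, stair_apply]
      omega
    simp only
    omega
  refine ⟨μ, hμ, funext fun i => ?_⟩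
  rw [expo, h]
  exact Nat.sub_add_cancel (key _ i rfl).1

theorem sum_expo {n : ℕ} {μ : YoungDiagram} (hμ : μ.colLen 0 ≤ n) :
    ∑ i, expo n μ i = μ.card + ∑ i, stair n i := by
  rw [← sum_rowFun hμ, ← Finset.sum_add_distrib]
  rfl

end Diagrams

/-! ### Coefficient extraction and alternating power series. -/

section Coefficients

variable {R : Type*} [CommRing R] {n : ℕ}

/-- A power series in one variable, viewed as a series in the `i`-th of `n` variables. -/
noncomputable def inVar (i : Fin n) : PowerSeries R →ₐ[R] MvPowerSeries (Fin n) R :=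
  MvPowerSeries.rename (⟨fun _ => i, Function.injective_of_subsingleton _⟩ : Unit ↪ Fin n)

theorem inVar_X (i : Fin n) : inVar i (PowerSeries.X : PowerSeries R) = MvPowerSeries.X i :=
  MvPowerSeries.rename_X _ _

theorem coeff_single_inVar (i : Fin n) (u : PowerSeries R) (k : ℕ) :
    MvPowerSeries.coeff (Finsupp.single i k) (inVar i u) = PowerSeries.coeff k u := by
  have := MvPowerSeries.coeff_embDomain_rename
    (⟨fun _ => i, Function.injective_of_subsingleton _⟩ : Unit ↪ Fin n) u (Finsupp.single () k)
  rwa [Finsupp.embDomain_single] at this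

theorem coeff_inVar_of_ne (i : Fin n) (u : PowerSeries R) {m : Fin n →₀ ℕ}
    (hm : m ≠ Finsupp.single i (m i)) : MvPowerSeries.coeff m (inVar i u) = 0 := by
  refine MvPowerSeries.coeff_rename_eq_zero (R := R) _ (p := u) ?_
  rintro ⟨x, rfl⟩
  apply hm
  have : x = Finsupp.single () (x ()) := by
    ext
    simp
  rw [this, Finsupp.mapDomain_single]
  exact congrArg _ Finsupp.single_eq_same.symm

/-- The coefficient of a power series in `n` variables at an exponent given as a function. -/
noncomputable def cf (α : Fin n → ℕ) : MvPowerSeries (Fin n) R →ₗ[R] R :=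
  MvPowerSeries.coeff (Finsupp.equivFunOnFinite.symm α)

theorem cf_prod_inVar (w : Fin n → PowerSeries R) (α : Fin n → ℕ) :
    cf α (∏ i, inVar i (w i)) = ∏ i, PowerSeries.coeff (α i) (w i) := by
  classical
  rw [cf, MvPowerSeries.coeff_prod, Finset.sum_eq_single
    (Finsupp.equivFunOnFinite.symm fun i => Finsupp.single i (α i))]
  · simp [coeff_single_inVar]
  · intro l hl hne
    rw [Finset.mem_finsuppAntidiag] at hl
    by_contra h
    have h1 : ∀ i, l i = Finsupp.single i (l i i) := fun i => by
      by_contra hi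
      exact h (Finset.prod_eq_zero (Finset.mem_univ i) (coeff_inVar_of_ne i _ hi))
    have h2 : ∀ j, l j j = α j := fun j => by
      have h3 := DFunLike.congr_fun hl.1 j
      rw [Finsupp.finsetSum_apply, Finset.sum_eq_single j] at h3
      · exact h3
      · intro i _ hij
        rw [h1 i]
        simp [hij]
      · simp
    apply hne
    ext i : 1
    rw [h1 i, h2 i]
    rfl
  · intro h
    refine absurd ?_ h
    rw [Finset.mem_finsuppAntidiag]
    refine ⟨?_, Finset.subset_univ _⟩
    ext j
    simp [Finsupp.finsetSum_apply, Finsupp.single_apply]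

/-- Row `i` involves only the `i`-th variable, so extracting a coefficient acts row by row. This is
how determinants of generating functions become Jacobi-Trudi type determinants. -/
theorem cf_det_inVar (u : Fin n → PowerSeries R) (α : Fin n → ℕ) :
    cf α (Matrix.det (Matrix.of fun i j => inVar i (u j))) =
      Matrix.det (Matrix.of fun i j => PowerSeries.coeff (α i) (u j)) := by
  rw [← Matrix.det_transpose, Matrix.det_apply, ← Matrix.det_transpose, Matrix.det_apply, map_sum]
  refine Finset.sum_congr rfl fun σ _ => ?_
  simp only [Matrix.transpose_apply, Matrix.of_apply]
  rw [← cf_prod_inVar, Units.smul_def, Units.smul_def, map_zsmul]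

/-- The alternating power series. -/
def IsAlt (f : MvPowerSeries (Fin n) R) : Prop :=
  ∀ (σ : Equiv.Perm (Fin n)) (α : Fin n → ℕ),
    cf (α ∘ σ) f = (Equiv.Perm.sign σ : ℤ) * cf α f

theorem isAlt_det_inVar (u : Fin n → PowerSeries R) :
    IsAlt (Matrix.det (Matrix.of fun i j => inVar i (u j))) := fun σ α => by
  rw [cf_det_inVar, cf_det_inVar, ← Matrix.det_permute]
  rfl

theorem alt_X (β : Fin n → ℕ) : alt (MvPowerSeries.X : Fin n → MvPowerSeries (Fin n) R) β =
    Matrix.det (Matrix.of fun i j => inVar i (PowerSeries.X ^ β j)) := by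
  rw [alt]
  congr 1
  ext1 i j
  simp only [Matrix.of_apply, map_pow, inVar_X]

theorem isAlt_alt (β : Fin n → ℕ) :
    IsAlt (alt (MvPowerSeries.X : Fin n → MvPowerSeries (Fin n) R) β) := by
  rw [alt_X]
  exact isAlt_det_inVar _

theorem cf_alt_self {β : Fin n → ℕ} (hβ : Function.Injective β) :
    cf β (alt (MvPowerSeries.X : Fin n → MvPowerSeries (Fin n) R) β) = 1 := by
  rw [alt_X, cf_det_inVar, ← Matrix.det_one (n := Fin n)]
  congr 1
  ext i j
  simp [PowerSeries.coeff_X_pow, Matrix.one_apply, hβ.eq_iff]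

/-- Strictly decreasing sequences are determined by their ranges, so some `α i` is missing from `β`
and gives a zero row. -/
theorem cf_alt_of_ne {α β : Fin n → ℕ} (hα : StrictAnti α) (hβ : StrictAnti β) (h : α ≠ β) :
    cf α (alt (MvPowerSeries.X : Fin n → MvPowerSeries (Fin n) R) β) = 0 := by
  have : ∃ i, ∀ j, α i ≠ β j := by
    by_contra! h'
    apply h
    rw [← StrictAnti.range_inj hα hβ]
    choose g hg using h'
    have hg' : Function.Injective g := fun i j hij => hα.injective (by rw [hg, hg, hij])
    refine le_antisymm ?_ ?_
    · rintro _ ⟨i, rfl⟩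
      exact ⟨g i, (hg i).symm⟩
    · rintro _ ⟨j, rfl⟩
      obtain ⟨i, rfl⟩ := (Finite.injective_iff_surjective.1 hg') j
      exact ⟨i, hg i⟩
  obtain ⟨i, hi⟩ := this
  rw [alt_X, cf_det_inVar]
  refine Matrix.det_eq_zero_of_row_eq_zero i fun j => ?_
  simp [PowerSeries.coeff_X_pow, hi j]

theorem cf_expo_alt {μ ν : YoungDiagram} (hμ : μ.colLen 0 ≤ n) (hν : ν.colLen 0 ≤ n)
    [Decidable (μ = ν)] :
    cf (expo n μ) (alt (MvPowerSeries.X : Fin n → MvPowerSeries (Fin n) R) (expo n ν)) =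
      if μ = ν then 1 else 0 := by
  split_ifs with h
  · rw [h]
    exact cf_alt_self (strictAnti_expo n ν).injective
  · exact cf_alt_of_ne (strictAnti_expo n μ) (strictAnti_expo n ν)
      fun h' => h (expo_injective hμ hν h')

theorem IsAlt.sub {f g : MvPowerSeries (Fin n) R} (hf : IsAlt f) (hg : IsAlt g) :
    IsAlt (f - g) := fun σ α => by
  rw [map_sub, map_sub, hf, hg, mul_sub]

theorem IsAlt.sum {ι : Type*} {s : Finset ι} {f : ι → MvPowerSeries (Fin n) R}
    (hf : ∀ i ∈ s, IsAlt (f i)) : IsAlt (∑ i ∈ s, f i) := fun σ α => by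
  rw [map_sum, map_sum, Finset.mul_sum]
  exact Finset.sum_congr rfl fun i hi => hf i hi σ α

theorem IsAlt.smul {f : MvPowerSeries (Fin n) R} (hf : IsAlt f) (c : R) :
    IsAlt (c • f) := fun σ α => by
  rw [map_smul, map_smul, hf, smul_eq_mul, smul_eq_mul, mul_left_comm]

/-- An exponent with a repetition has coefficient equal to its own negative; any other can be sorted
into the form `λ + δ`, at the price of a sign. -/
theorem IsAlt.eq_zero [IsDomain R] [CharZero R] {f : MvPowerSeries (Fin n) R} (hf : IsAlt f)
    (h : ∀ μ : YoungDiagram, μ.colLen 0 ≤ n → cf (expo n μ) f = 0) : f = 0 := by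
  ext m
  obtain ⟨α, rfl⟩ := Finsupp.equivFunOnFinite.symm.surjective m
  change cf α f = 0
  by_cases hα : Function.Injective α
  · set σ := Tuple.sort (OrderDual.toDual ∘ α) with hσ
    have h1 : StrictAnti (α ∘ σ) := by
      have h2 : Antitone (α ∘ σ) := fun i j hij => Tuple.monotone_sort (OrderDual.toDual ∘ α) hij
      exact h2.strictAnti_of_injective (hα.comp σ.injective)
    obtain ⟨μ, hμ, h2⟩ := exists_expo_eq h1
    have h3 := h μ hμ
    rw [h2, hf] at h3
    rcases Int.units_eq_one_or (Equiv.Perm.sign σ) with h4 | h4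
    · simpa [h4] using h3
    · simpa [h4] using h3
  · rw [Function.Injective] at hα
    push Not at hα
    obtain ⟨i, j, hij, hne⟩ := hα
    have h1 : α ∘ Equiv.swap i j = α := by
      ext k
      rw [Function.comp_apply, Equiv.swap_apply_def]
      split_ifs with h2 h3
      · rw [h2, hij]
      · rw [h3, hij]
      · rfl
    have h2 := hf (Equiv.swap i j) α
    rw [h1, Equiv.Perm.sign_swap hne] at h2
    simpa [self_eq_neg] using h2

end Coefficients

/-! ### The grading by degree, recorded by an auxiliary variable. -/

section Homogeneous

variable {R : Type*} [CommRing R] {σ : Type*}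

/-- The series `∑ f_d z^d`, where `f_d` is the homogeneous component of degree `d` of `f`. -/
noncomputable def hom : MvPowerSeries σ R →+* PowerSeries (MvPowerSeries σ R) where
  toFun f := PowerSeries.mk fun d => MvPowerSeries.homogeneousComponent d f
  map_zero' := by
    ext
    simp
  map_one' := by
    classical
    ext d m
    rw [PowerSeries.coeff_mk, MvPowerSeries.coeff_homogeneousComponent, PowerSeries.coeff_one,
      MvPowerSeries.coeff_one]
    split_ifs with h1 h2 h3 h4 h5
    · simp [h2]
    · exact absurd (by rw [← h1, h2]; simp) h3
    · simp [MvPowerSeries.coeff_one, h2]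
    · simp
    · rw [MvPowerSeries.coeff_one, if_neg]
      rintro rfl
      exact h1 (by simp [h5])
    · simp
  map_add' f g := by
    ext
    simp
  map_mul' f g := by
    classical
    ext d m
    rw [PowerSeries.coeff_mk, MvPowerSeries.coeff_homogeneousComponent, PowerSeries.coeff_mul,
      map_sum]
    simp_rw [MvPowerSeries.coeff_mul, PowerSeries.coeff_mk,
      MvPowerSeries.coeff_homogeneousComponent]
    rw [Finset.sum_comm]
    split_ifs with h
    · refine Finset.sum_congr rfl fun p hp => ?_
      rw [Finset.HasAntidiagonal.mem_antidiagonal] at hp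
      rw [Finset.sum_eq_single (p.1.degree, p.2.degree)]
      · simp
      · rintro ⟨a, b⟩ _ hab
        by_cases ha : p.1.degree = a
        · by_cases hb : p.2.degree = b
          · exact absurd (by rw [ha, hb]) hab
          · rw [if_neg hb, mul_zero]
        · rw [if_neg ha, zero_mul]
      · intro hp'
        refine absurd ?_ hp'
        rw [Finset.HasAntidiagonal.mem_antidiagonal, ← h, ← hp, map_add]
    · refine (Finset.sum_eq_zero fun p hp => Finset.sum_eq_zero fun x hx => ?_).symm
      rw [Finset.HasAntidiagonal.mem_antidiagonal] at hp hx
      dsimp only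
      by_cases ha : p.1.degree = x.1
      · rw [if_neg (c := p.2.degree = x.2), mul_zero]
        intro hb
        apply h
        rw [← hp, map_add, ha, hb, hx]
      · rw [if_neg ha, zero_mul]

theorem coeff_hom (f : MvPowerSeries σ R) (d : ℕ) :
    PowerSeries.coeff d (hom f) = MvPowerSeries.homogeneousComponent d f :=
  PowerSeries.coeff_mk d fun d => MvPowerSeries.homogeneousComponent d f

theorem hom_X (i : σ) : hom (MvPowerSeries.X i : MvPowerSeries σ R) =
    PowerSeries.C (MvPowerSeries.X i) * PowerSeries.X := by
  classical
  ext d m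
  rw [coeff_hom, MvPowerSeries.coeff_homogeneousComponent, PowerSeries.coeff_C_mul,
    PowerSeries.coeff_X, MvPowerSeries.coeff_X]
  by_cases hm : m = Finsupp.single i 1
  · subst hm
    by_cases hd : d = 1
    · simp [hd]
    · simp [hd, Ne.symm hd]
  · simp only [hm, if_false, ite_self]
    split_ifs
    · simp [MvPowerSeries.coeff_X, hm]
    · simp

end Homogeneous

/-! ### Homogeneous power series and homogeneity of determinants. -/

section HomogeneousSeries

variable {R : Type*} [CommRing R] {σ : Type*}

/-- The power series that are homogeneous of degree `d`. -/
def IsHomog (f : MvPowerSeries σ R) (d : ℤ) : Prop :=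
  ∀ m, MvPowerSeries.coeff m f ≠ 0 → (m.degree : ℤ) = d

theorem IsHomog.mul {f g : MvPowerSeries σ R} {d e : ℤ} (hf : IsHomog f d) (hg : IsHomog g e) :
    IsHomog (f * g) (d + e) := fun m hm => by
  classical
  rw [MvPowerSeries.coeff_mul] at hm
  obtain ⟨p, hp, h⟩ := Finset.exists_ne_zero_of_sum_ne_zero hm
  rw [Finset.HasAntidiagonal.mem_antidiagonal] at hp
  rw [← hp, map_add, Nat.cast_add, hf _ (left_ne_zero_of_mul h), hg _ (right_ne_zero_of_mul h)]

theorem IsHomog.one : IsHomog (1 : MvPowerSeries σ R) 0 := fun m hm => by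
  classical
  rw [MvPowerSeries.coeff_one] at hm
  split_ifs at hm with h
  · simp [h]
  · exact absurd rfl hm

theorem IsHomog.prod {ι : Type*} (s : Finset ι) {f : ι → MvPowerSeries σ R} {d : ι → ℤ}
    (hf : ∀ i, IsHomog (f i) (d i)) : IsHomog (∏ i ∈ s, f i) (∑ i ∈ s, d i) := by
  classical
  induction s using Finset.induction_on with
  | empty => simpa using IsHomog.one
  | insert a s ha ih =>
    rw [Finset.prod_insert ha, Finset.sum_insert ha]
    exact (hf a).mul ih

theorem IsHomog.sum {ι : Type*} {s : Finset ι} {f : ι → MvPowerSeries σ R} {d : ℤ}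
    (hf : ∀ i ∈ s, IsHomog (f i) d) : IsHomog (∑ i ∈ s, f i) d := fun m hm => by
  rw [map_sum] at hm
  obtain ⟨i, hi, h⟩ := Finset.exists_ne_zero_of_sum_ne_zero hm
  exact hf i hi m h

theorem IsHomog.zsmul {f : MvPowerSeries σ R} {d : ℤ} (hf : IsHomog f d) (c : ℤ) :
    IsHomog (c • f) d := fun m hm => by
  rw [map_zsmul] at hm
  exact hf m fun h => hm (by rw [h, smul_zero])

theorem IsHomog.sub {f g : MvPowerSeries σ R} {d : ℤ} (hf : IsHomog f d) (hg : IsHomog g d) :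
    IsHomog (f - g) d := fun m hm => by
  rw [map_sub] at hm
  by_cases h : MvPowerSeries.coeff m f = 0
  · exact hg m fun h' => hm (by rw [h, h', sub_zero])
  · exact hf m h

theorem IsHomog.det {n : ℕ} {M : Matrix (Fin n) (Fin n) (MvPowerSeries σ R)} {a b : Fin n → ℤ}
    (hM : ∀ i j, IsHomog (M i j) (a i + b j)) : IsHomog M.det (∑ i, a i + ∑ i, b i) := by
  rw [Matrix.det_apply]
  refine IsHomog.sum fun τ _ => ?_
  rw [Units.smul_def]
  refine IsHomog.zsmul ?_ _
  have := IsHomog.prod Finset.univ fun i => hM (τ i) i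
  rwa [Finset.sum_add_distrib, Equiv.sum_comp τ a] at this

theorem isHomog_alt {n : ℕ} (β : Fin n → ℕ) :
    IsHomog (alt (MvPowerSeries.X : Fin n → MvPowerSeries (Fin n) R) β) (∑ i, (β i : ℤ)) := by
  classical
  have := IsHomog.det (M := Matrix.of fun i j =>
    (MvPowerSeries.X i : MvPowerSeries (Fin n) R) ^ β j) (a := fun _ => 0) (b := fun i => (β i : ℤ))
    fun i j m hm => by
      rw [Matrix.of_apply, MvPowerSeries.coeff_X_pow] at hm
      split_ifs at hm with h
      · simp [h]
      · exact absurd rfl hm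
  rw [alt]
  simpa using this

end HomogeneousSeries

/-! ### Behaviour under ring homomorphisms and permutations of the variables. -/

section Maps

variable {A B : Type*} [CommRing A] [CommRing B] {n : ℕ}

theorem hSeries_map (φ : A →+* B) (t : Fin n → A) :
    hSeries (fun i => φ (t i)) = PowerSeries.map φ (hSeries t) := by
  have h1 := hSeries_mul fun i => φ (t i)
  have h2 := congrArg (PowerSeries.map φ) (hSeries_mul t)
  simp only [map_mul, map_prod, map_sub, map_one, PowerSeries.map_C, PowerSeries.map_X] at h2
  calc _ = hSeries (fun i => φ (t i)) * (PowerSeries.map φ (hSeries t) *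
        ∏ i, (1 - PowerSeries.C (φ (t i)) * PowerSeries.X)) := by rw [h2, mul_one]
    _ = hSeries (fun i => φ (t i)) * (∏ i, (1 - PowerSeries.C (φ (t i)) * PowerSeries.X)) *
        PowerSeries.map φ (hSeries t) := by ring
    _ = _ := by rw [h1, one_mul]

theorem hPoly_map (φ : A →+* B) (t : Fin n → A) (r : ℤ) :
    hPoly (fun i => φ (t i)) r = φ (hPoly t r) := by
  rw [hPoly, hPoly, hSeries_map, intCoeff, intCoeff]
  split_ifs <;> simp

theorem schur_map (φ : A →+* B) (t : Fin n → A) (l : Fin n → ℕ) :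
    schur (fun i => φ (t i)) l = φ (schur t l) := by
  rw [schur, schur, RingHom.map_det]
  congr 1
  ext i j
  simp [hPoly_map]

theorem alt_map (φ : A →+* B) (t : Fin n → A) (β : Fin n → ℕ) :
    alt (fun i => φ (t i)) β = φ (alt t β) := by
  rw [alt, alt, RingHom.map_det]
  congr 1
  ext i j
  simp

theorem schur_perm (t : Fin n → A) (l : Fin n → ℕ) (τ : Equiv.Perm (Fin n)) :
    schur (fun i => t (τ i)) l = schur t l := by
  have : hSeries (fun i => t (τ i)) = hSeries t := by
    rw [hSeries, hSeries, Equiv.prod_comp τ fun i => 1 - PowerSeries.C (t i) * PowerSeries.X]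
  simp only [schur, hPoly, this]

theorem alt_perm_vars (t : Fin n → A) (β : Fin n → ℕ) (τ : Equiv.Perm (Fin n)) :
    alt (fun i => t (τ i)) β = (Equiv.Perm.sign τ : ℤ) * alt t β :=
  Matrix.det_permute τ (Matrix.of fun i j => t i ^ β j)

theorem cf_rename {R : Type*} [CommRing R] (f : MvPowerSeries (Fin n) R) (τ : Equiv.Perm (Fin n))
    (α : Fin n → ℕ) : cf α (MvPowerSeries.rename τ f) = cf (α ∘ τ) f := by
  have h := MvPowerSeries.coeff_embDomain_rename τ.toEmbedding f
    (Finsupp.equivFunOnFinite.symm (α ∘ τ))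
  rw [cf, cf, ← h]
  congr 2
  ext i
  have := Finsupp.embDomain_apply_self τ.toEmbedding (Finsupp.equivFunOnFinite.symm (α ∘ τ))
    (τ.symm i)
  simp only [Equiv.coe_toEmbedding, Equiv.apply_symm_apply] at this
  rw [this]
  simp

theorem isAlt_alt_mul_schur {R : Type*} [CommRing R] (β l : Fin n → ℕ) :
    IsAlt (alt (MvPowerSeries.X : Fin n → MvPowerSeries (Fin n) R) β *
      schur (MvPowerSeries.X : Fin n → MvPowerSeries (Fin n) R) l) := fun τ α => by
  rw [← cf_rename, map_mul]
  have h1 := alt_map (MvPowerSeries.rename (R := R) τ).toRingHom MvPowerSeries.X β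
  have h2 := schur_map (MvPowerSeries.rename (R := R) τ).toRingHom MvPowerSeries.X l
  simp only [AlgHom.toRingHom_eq_coe, RingHom.coe_coe, MvPowerSeries.rename_X] at h1 h2
  rw [← h1, ← h2, schur_perm, alt_perm_vars, mul_assoc, ← zsmul_eq_mul, map_zsmul, zsmul_eq_mul]

end Maps

/-! ### Restricting symmetric functions to finitely many variables. -/

section Specialization

/-- Setting all variables of a symmetric function but the first `n` to zero. -/
noncomputable def toVars (n : ℕ) : Lam →+* MvPowerSeries (Fin n) ℤ :=
  (MvPowerSeries.killCompl (R := ℤ) Fin.valEmbedding).toRingHom.comp Lam.subtype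

theorem coeff_toVars (n : ℕ) (f : Lam) (m : Fin n →₀ ℕ) :
    MvPowerSeries.coeff m (toVars n f) =
      MvPowerSeries.coeff (Finsupp.embDomain Fin.valEmbedding m) (f : MvPowerSeries ℕ ℤ) :=
  MvPowerSeries.coeff_killCompl _ _

theorem degree_embDomain {σ τ : Type*} (e : σ ↪ τ) (m : σ →₀ ℕ) :
    (Finsupp.embDomain e m).degree = m.degree :=
  Finsupp.sum_embDomain (v := m) (f := e) (g := fun _ x => x)

theorem coeff_h (r : ℤ) (m : ℕ →₀ ℕ) :
    MvPowerSeries.coeff m (h r : MvPowerSeries ℕ ℤ) = if (m.degree : ℤ) = r then 1 else 0 :=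
  rfl

/-- All coefficients of `∏ 1 / (1 - X_i)` are one, and `hom`, which sends `X_i` to `X_i z`, turns
this product into `hSeries`. Thus the coefficient of `z^r` is the sum of all monomials of degree
`r`. -/
theorem coeff_hSeries_X {R : Type*} [CommRing R] {n : ℕ} (r : ℕ) (m : Fin n →₀ ℕ) :
    MvPowerSeries.coeff m (PowerSeries.coeff r
      (hSeries (MvPowerSeries.X : Fin n → MvPowerSeries (Fin n) R))) =
        if m.degree = r then 1 else 0 := by
  set H : MvPowerSeries (Fin n) R := ∏ i, inVar i (PowerSeries.mk 1) with hH
  have h1 : H * ∏ i, (1 - MvPowerSeries.X i) = 1 := by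
    rw [hH, ← Finset.prod_mul_distrib]
    refine Finset.prod_eq_one fun i _ => ?_
    rw [← inVar_X, ← map_one (inVar (R := R) i), ← map_sub, ← map_mul,
      PowerSeries.mk_one_mul_one_sub_eq_one]
  have hX : ∀ i : Fin n, hom (1 - MvPowerSeries.X i : MvPowerSeries (Fin n) R) =
      1 - PowerSeries.C (MvPowerSeries.X i) * PowerSeries.X := fun i => by
    rw [map_sub, map_one, hom_X]
  have h2 : hom H * ∏ i : Fin n, (1 - PowerSeries.C (MvPowerSeries.X i) * PowerSeries.X) = 1 := by
    refine Eq.trans ?_ ((congrArg hom h1).trans (map_one hom))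
    rw [map_mul, map_prod hom fun i => 1 - MvPowerSeries.X i]
    exact congrArg _ (Finset.prod_congr rfl fun i _ => (hX i).symm)
  have h3 : hSeries (MvPowerSeries.X : Fin n → MvPowerSeries (Fin n) R) = hom H := by
    calc _ = hSeries (MvPowerSeries.X : Fin n → MvPowerSeries (Fin n) R) * (hom H *
          ∏ i, (1 - PowerSeries.C (MvPowerSeries.X i) * PowerSeries.X)) := by rw [h2, mul_one]
      _ = hSeries (MvPowerSeries.X : Fin n → MvPowerSeries (Fin n) R) *
          (∏ i, (1 - PowerSeries.C (MvPowerSeries.X i) * PowerSeries.X)) * hom H := by ring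
      _ = _ := by rw [hSeries_mul, one_mul]
  rw [h3, coeff_hom, MvPowerSeries.coeff_homogeneousComponent]
  obtain ⟨α, rfl⟩ := Finsupp.equivFunOnFinite.symm.surjective m
  have h4 : cf α H = 1 := by
    rw [hH, cf_prod_inVar]
    simp
  rw [← h4]
  rfl

theorem toVars_h (n : ℕ) (r : ℤ) : toVars n (h r) = hPoly MvPowerSeries.X r := by
  ext m
  rw [coeff_toVars, coeff_h, degree_embDomain, hPoly, intCoeff]
  split_ifs with h1 h2 h2
  · rw [coeff_hSeries_X, if_pos (by omega)]
  · omega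
  · rw [coeff_hSeries_X, if_neg (by omega)]
  · simp

theorem h_zero : h 0 = 1 := by
  classical
  ext m
  rw [coeff_h, OneMemClass.coe_one, MvPowerSeries.coeff_one]
  simp only [Nat.cast_eq_zero, Finsupp.degree_eq_zero_iff]

theorem h_of_neg {r : ℤ} (hr : r < 0) : h r = 0 := by
  ext m
  rw [coeff_h, if_neg (by omega)]
  simp

/-- The added rows vanish left of a unit diagonal, so expansion along the last row does not change
the determinant. Hence zero parts may be appended to a partition. -/
theorem det_stable {R : Type*} [CommRing R] (g : ℕ → ℕ → R) (l n : ℕ) (hn : l ≤ n)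
    (h0 : ∀ i j, l ≤ i → j < i → g i j = 0) (h1 : ∀ i, l ≤ i → g i i = 1) :
    (Matrix.of fun i j : Fin l => g i j).det = (Matrix.of fun i j : Fin n => g i j).det := by
  induction n, hn using Nat.le_induction with
  | base => rfl
  | succ n hn ih =>
    rw [ih, Matrix.det_succ_row (Matrix.of fun i j : Fin (n + 1) => g i j) (Fin.last n),
      Finset.sum_eq_single (Fin.last n)]
    · simp only [Matrix.of_apply, Fin.val_last, h1 n hn, mul_one, ← two_mul, pow_mul, neg_one_sq,
        one_pow, one_mul]
      congr 1
      ext i j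
      simp
    · intro j _ hj
      have : (j : ℕ) < n := Fin.val_lt_last hj
      simp [h0 n j hn this]
    · simp

theorem sGl_eq {n : ℕ} {μ : YoungDiagram} (hμ : μ.colLen 0 ≤ n) :
    sGl μ = Matrix.det (Matrix.of fun i j : Fin n =>
      h ((μ.rowLen i : ℤ) - (i : ℤ) + (j : ℤ))) := by
  refine det_stable (fun i j => h ((μ.rowLen i : ℤ) - (i : ℤ) + (j : ℤ))) _ n hμ
    (fun i j hi hj => ?_) fun i hi => ?_
  · rw [rowLen_eq_zero hi, h_of_neg (by omega)]
  · rw [rowLen_eq_zero hi]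
    simp [h_zero]

theorem sSo_eq {n : ℕ} {μ : YoungDiagram} (hμ : μ.colLen 0 ≤ n) :
    sSo μ = Matrix.det (Matrix.of fun i j : Fin n =>
      h ((μ.rowLen i : ℤ) - (i : ℤ) + (j : ℤ)) -
        h ((μ.rowLen i : ℤ) - (i : ℤ) - (j : ℤ) - 2)) := by
  refine det_stable (fun i j => h ((μ.rowLen i : ℤ) - (i : ℤ) + (j : ℤ)) -
    h ((μ.rowLen i : ℤ) - (i : ℤ) - (j : ℤ) - 2)) _ n hμ (fun i j hi hj => ?_) fun i hi => ?_
  · rw [rowLen_eq_zero hi, h_of_neg (by omega), h_of_neg (by omega), sub_zero]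
  · rw [rowLen_eq_zero hi, h_of_neg (r := ((0 : ℕ) : ℤ) - i - i - 2) (by omega)]
    simp [h_zero]

theorem sSp_eq {n : ℕ} {μ : YoungDiagram} (hμ : μ.colLen 0 ≤ n) :
    sSp μ = Matrix.det (Matrix.of fun i j : Fin n =>
      if (j : ℕ) = 0 then h ((μ.rowLen i : ℤ) - (i : ℤ))
      else h ((μ.rowLen i : ℤ) - (i : ℤ) + (j : ℤ)) +
        h ((μ.rowLen i : ℤ) - (i : ℤ) - (j : ℤ))) := by
  refine det_stable (fun i j => if j = 0 then h ((μ.rowLen i : ℤ) - (i : ℤ))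
      else h ((μ.rowLen i : ℤ) - (i : ℤ) + (j : ℤ)) +
        h ((μ.rowLen i : ℤ) - (i : ℤ) - (j : ℤ))) _ n hμ (fun i j hi hj => ?_) fun i hi => ?_
  · simp only [rowLen_eq_zero hi]
    split_ifs
    · rw [h_of_neg (by omega)]
    · rw [h_of_neg (by omega), h_of_neg (by omega), add_zero]
  · simp only [rowLen_eq_zero hi]
    split_ifs with hi0
    · simp [hi0, h_zero]
    · rw [h_of_neg (r := ((0 : ℕ) : ℤ) - i - i) (by omega)]
      simp [h_zero]

theorem toVars_sGl {n : ℕ} {μ : YoungDiagram} (hμ : μ.colLen 0 ≤ n) :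
    toVars n (sGl μ) = schur MvPowerSeries.X (rowFun n μ) := by
  rw [sGl_eq hμ, RingHom.map_det, schur]
  congr 1
  ext1 i j
  simp [toVars_h, rowFun]

theorem vand_mul_toVars_sGl {n : ℕ} {μ : YoungDiagram} (hμ : μ.colLen 0 ≤ n) :
    vand MvPowerSeries.X * toVars n (sGl μ) = alt MvPowerSeries.X (expo n μ) := by
  rw [toVars_sGl hμ, ← alt_add_stair]
  rfl

theorem isHomog_h (r : ℤ) : IsHomog (h r : MvPowerSeries ℕ ℤ) r := fun m hm => by
  rw [coeff_h] at hm
  by_contra h'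
  exact hm (if_neg h')

/-- Give row `i` degree `μ_i - i` and column `j` degree `j`; the staircase contributions cancel. -/
theorem isHomog_sGl (μ : YoungDiagram) : IsHomog (sGl μ : MvPowerSeries ℕ ℤ) μ.card := by
  have h1 := RingHom.map_det Lam.subtype (Matrix.of fun i j : Fin (μ.colLen 0) =>
    h ((μ.rowLen i : ℤ) - (i : ℤ) + (j : ℤ)))
  rw [sGl, ← Lam.subtype_apply, h1]
  have h2 := IsHomog.det (M := Lam.subtype.mapMatrix (Matrix.of fun i j : Fin (μ.colLen 0) =>
    h ((μ.rowLen i : ℤ) - (i : ℤ) + (j : ℤ)))) (a := fun i => (μ.rowLen i : ℤ) - (i : ℤ))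
    (b := fun j => (j : ℤ)) fun i j => isHomog_h _
  rwa [Finset.sum_sub_distrib, sub_add_cancel, ← Nat.cast_sum,
    show ∑ i : Fin (μ.colLen 0), μ.rowLen i = μ.card from sum_rowFun le_rfl] at h2

theorem isHomog_toVars (n : ℕ) {f : Lam} {d : ℤ} (hf : IsHomog (f : MvPowerSeries ℕ ℤ) d) :
    IsHomog (toVars n f) d := fun m hm => by
  rw [coeff_toVars] at hm
  rw [← degree_embDomain Fin.valEmbedding, hf _ hm]

theorem card_support_le_degree {σ : Type*} (m : σ →₀ ℕ) : m.support.card ≤ m.degree := by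
  rw [Finset.card_eq_sum_ones]
  exact Finset.sum_le_sum fun i hi => Nat.pos_of_ne_zero (Finsupp.mem_support_iff.1 hi)

/-- A monomial of degree at most `n` involves at most `n` variables, and by symmetry these can be
moved to the first `n`. -/
theorem eq_zero_of_toVars_eq_zero {n d : ℕ} (hd : d ≤ n) {f : Lam}
    (hf : IsHomog (f : MvPowerSeries ℕ ℤ) d) (h0 : toVars n f = 0) : f = 0 := by
  ext m
  by_contra hm
  change MvPowerSeries.coeff m (f : MvPowerSeries ℕ ℤ) ≠ 0 at hm
  have hdeg : m.degree = d := by exact_mod_cast hf m hm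
  have hcard : m.support.card ≤ n := (card_support_le_degree m).trans (hdeg.le.trans hd)
  set e := m.support.equivFin with he
  -- A permutation of `ℕ` carrying the support of `m` onto an initial segment.
  obtain ⟨τ, hτ⟩ := Equiv.Perm.exists_extending_pair
    (fun i : Fin m.support.card => ((e.symm i : ℕ))) (fun i => (i : ℕ))
    (fun i j hij => e.symm.injective (Subtype.ext hij)) Fin.val_injective
  have h1 : Finsupp.embDomain τ.toEmbedding m ∈
      Set.range (Finsupp.embDomain (Fin.valEmbedding (n := n)) (M := ℕ)) := by
    rw [Finsupp.mem_range_embDomain_iff, Finsupp.support_embDomain]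
    intro k hk
    simp only [Finset.coe_map, Equiv.coe_toEmbedding, Set.mem_image] at hk
    obtain ⟨i, hi, rfl⟩ := hk
    have h2 := hτ (e ⟨i, hi⟩)
    simp only [Equiv.symm_apply_apply] at h2
    rw [h2]
    exact ⟨⟨e ⟨i, hi⟩, (e ⟨i, hi⟩).is_lt.trans_le hcard⟩, rfl⟩
  obtain ⟨m', hm'⟩ := h1
  have h3 := MvPowerSeries.coeff_embDomain_rename τ.toEmbedding (f : MvPowerSeries ℕ ℤ) m
  have h4 : MvPowerSeries.rename τ.toEmbedding (f : MvPowerSeries ℕ ℤ) = f := f.2.2 τ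
  rw [h4, ← hm', ← coeff_toVars, h0] at h3
  exact hm (by rw [← h3]; simp)

end Specialization

/-! ### Littlewood-Richardson coefficients through alternants. -/

section LittlewoodRichardson

theorem vand_ne_zero {R : Type*} [CommRing R] [Nontrivial R] (n : ℕ) :
    vand (MvPowerSeries.X : Fin n → MvPowerSeries (Fin n) R) ≠ 0 := fun h0 => by
  have h1 : Function.Injective (stair n) := fun i j hij => by
    have := i.is_lt
    have := j.is_lt
    rw [stair_apply, stair_apply] at hij
    exact Fin.ext (by omega)
  have h2 := cf_alt_self (R := R) h1
  rw [← vand, h0, map_zero] at h2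
  exact zero_ne_one h2

/-- After multiplication by the Vandermonde determinant, the coefficient at `μ + δ` isolates `c μ`.
-/
theorem linearIndependent_sGl :
    Function.Injective fun c : YoungDiagram →₀ ℤ => Finsupp.linearCombination ℤ sGl c := by
  classical
  refine (injective_iff_map_eq_zero (Finsupp.linearCombination ℤ sGl)).2 fun c hc => ?_
  ext μ
  rw [Finsupp.zero_apply]
  by_contra hμ
  set n := c.support.sup fun ν => ν.colLen 0 with hn
  have hle : ∀ ν ∈ c.support, ν.colLen 0 ≤ n := fun ν hν =>
    Finset.le_sup (f := fun ν : YoungDiagram => ν.colLen 0) hν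
  have h1 := congrArg (fun f => cf (expo n μ) (vand MvPowerSeries.X * toVars n f)) hc
  simp only [map_zero, mul_zero] at h1
  rw [Finsupp.linearCombination_apply, Finsupp.sum, map_sum, Finset.mul_sum, map_sum,
    Finset.sum_eq_single μ] at h1
  · rw [map_zsmul, mul_smul_comm, vand_mul_toVars_sGl (hle μ (Finsupp.mem_support_iff.2 hμ)),
      map_zsmul, cf_alt_self (strictAnti_expo n μ).injective] at h1
    simp at h1
    exact hμ h1
  · intro ν hν hne
    rw [map_zsmul, mul_smul_comm, vand_mul_toVars_sGl (hle ν hν), map_zsmul,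
      cf_expo_alt (hle μ (Finsupp.mem_support_iff.2 hμ)) (hle ν hν), if_neg hne.symm, smul_zero]
  · intro h'
    exact absurd (Finsupp.mem_support_iff.2 hμ) h'

/-- In `d` variables `a_{μ+δ} s_γ` is alternating, hence a combination of alternants `a_{ν+δ}`.
Cancelling the Vandermonde determinant gives the expansion in `d` variables, and these suffice
because the product has degree `d`. -/
theorem exists_sGl_mul_sGl (μ γ : YoungDiagram) : ∃ c : YoungDiagram →₀ ℤ,
    (∀ ν, c ν ≠ 0 → ν.card = μ.card + γ.card) ∧
      Finsupp.linearCombination ℤ sGl c = sGl μ * sGl γ := by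
  classical
  set d := μ.card + γ.card with hd
  set F : MvPowerSeries (Fin d) ℤ :=
    alt MvPowerSeries.X (expo d μ) * schur MvPowerSeries.X (rowFun d γ) with hF
  have hμ : μ.colLen 0 ≤ d := (colLen_le_card μ).trans (by omega)
  have hγ : γ.colLen 0 ≤ d := (colLen_le_card γ).trans (by omega)
  have hF' : F = vand MvPowerSeries.X * toVars d (sGl μ * sGl γ) := by
    rw [hF, map_mul, ← mul_assoc, vand_mul_toVars_sGl hμ, toVars_sGl hγ]
  have hhom : IsHomog ((sGl μ * sGl γ : Lam) : MvPowerSeries ℕ ℤ) d := by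
    rw [hd, Nat.cast_add, Subring.coe_mul]
    exact (isHomog_sGl μ).mul (isHomog_sGl γ)
  have hFhom : IsHomog F (∑ i, (stair d i : ℤ) + d) := by
    rw [hF']
    exact (isHomog_alt _).mul (isHomog_toVars d hhom)
  set c : YoungDiagram →₀ ℤ := Finsupp.onFinset (parts d)
    (fun ν => if ν ∈ parts d then cf (expo d ν) F else 0) (fun ν hν => by
      by_contra h'
      exact hν (if_neg h')) with hc
  have hcapp : ∀ ν ∈ parts d, c ν = cf (expo d ν) F := fun ν hν => by
    rw [hc, Finsupp.onFinset_apply, if_pos hν]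
  have hsum : Finsupp.linearCombination ℤ sGl c = ∑ ν ∈ parts d, cf (expo d ν) F • sGl ν := by
    rw [Finsupp.linearCombination_apply,
      Finsupp.sum_of_support_subset c (s := parts d) Finsupp.support_onFinset_subset]
    · exact Finset.sum_congr rfl fun ν hν => by rw [hcapp ν hν]
    · intro ν _
      rw [zero_smul]
  refine ⟨c, fun ν hν => ?_, ?_⟩
  · by_contra h'
    rw [← mem_parts] at h'
    exact hν (by rw [hc, Finsupp.onFinset_apply, if_neg h'])
  -- Coefficients at `ρ + δ` are compared. For `ρ` of size different from `d`, the coefficient of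
  -- `F` vanishes by homogeneity.
  · have key : F - ∑ ν ∈ parts d, cf (expo d ν) F • alt MvPowerSeries.X (expo d ν) = 0 := by
      refine ((isAlt_alt_mul_schur _ _).sub (IsAlt.sum fun ν _ =>
        (isAlt_alt _).smul _)).eq_zero fun ρ hρ => ?_
      rw [map_sub, map_sum]
      simp_rw [map_smul]
      by_cases h1 : ρ ∈ parts d
      · rw [Finset.sum_eq_single ρ]
        · rw [cf_alt_self (strictAnti_expo d ρ).injective, smul_eq_mul, mul_one, sub_self]
        · intro ν hν hne
          rw [cf_expo_alt hρ (colLen_le_of_mem_parts le_rfl hν), if_neg hne.symm, smul_zero]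
        · exact fun h' => absurd h1 h'
      · rw [Finset.sum_eq_zero, sub_zero]
        · by_contra h2
          have h3 := hFhom _ h2
          have h4 : (Finsupp.equivFunOnFinite.symm (expo d ρ)).degree = ∑ i, expo d ρ i := by
            rw [Finsupp.degree_eq_sum]
            rfl
          rw [h4, sum_expo hρ] at h3
          apply h1
          rw [mem_parts]
          push_cast at h3
          omega
        · intro ν hν
          rw [cf_expo_alt hρ (colLen_le_of_mem_parts le_rfl hν), if_neg, smul_zero]
          rintro rfl
          exact h1 hν
    rw [hsum, ← sub_eq_zero, ← neg_eq_zero, neg_sub]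
    refine eq_zero_of_toVars_eq_zero (le_refl d) ?_ ?_
    · rw [AddSubgroupClass.coe_sub]
      refine hhom.sub ?_
      rw [AddSubmonoidClass.coe_finsetSum]
      refine IsHomog.sum fun ν hν => ?_
      have h1 := (isHomog_sGl ν).zsmul (cf (expo d ν) F)
      rwa [mem_parts.1 hν] at h1
    · refine (mul_eq_zero.1 ?_).resolve_left (vand_ne_zero (R := ℤ) d)
      rw [map_sub, mul_sub, ← hF', map_sum, Finset.mul_sum, ← key]
      congr 1
      refine Finset.sum_congr rfl fun ν hν => ?_
      rw [map_zsmul, mul_smul_comm, vand_mul_toVars_sGl (colLen_le_of_mem_parts le_rfl hν)]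

/-- Injectivity makes `Function.invFun` a left inverse, so it returns the explicit finite expansion
of `sGl μ * sGl γ`; surjectivity onto `Λ` is not needed. -/
theorem lrCoeff_spec (μ γ : YoungDiagram) :
    (∀ ν, lrCoeff μ γ ν ≠ 0 → ν.card = μ.card + γ.card) ∧
      sGl μ * sGl γ = ∑ ν ∈ parts (μ.card + γ.card), lrCoeff μ γ ν • sGl ν := by
  obtain ⟨c, hc, hsum⟩ := exists_sGl_mul_sGl μ γ
  have h1 : ∀ ν, lrCoeff μ γ ν = c ν := fun ν => by
    rw [lrCoeff, ← hsum]
    exact DFunLike.congr_fun (Function.leftInverse_invFun linearIndependent_sGl c) ν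
  simp_rw [h1]
  refine ⟨hc, ?_⟩
  rw [← hsum, Finsupp.linearCombination_apply, Finsupp.sum_of_support_subset]
  · intro ν hν
    rw [mem_parts]
    exact hc ν (Finsupp.mem_support_iff.1 hν)
  · intro ν _
    rw [zero_smul]

end LittlewoodRichardson

/-! ### Generating functions of the universal characters and the branching rules. -/

section Branching

/-- `Λ` serves as a coefficient ring below, where `IsAlt.eq_zero` and cancellation of the
Vandermonde determinant require a domain of characteristic zero. -/
instance : IsDomain Lam := by
  have : IsDomain (MvPowerSeries ℕ ℤ) := NoZeroDivisors.to_isDomain _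
  infer_instance

instance : CharZero Lam where
  cast_injective a b hab := by
    have h1 := congrArg (fun f : Lam => MvPowerSeries.constantCoeff (f : MvPowerSeries ℕ ℤ)) hab
    simpa using h1

variable {n : ℕ}

/-- The generating series of the complete homogeneous symmetric functions. -/
noncomputable def hGen : PowerSeries Lam := PowerSeries.mk fun r => h r

theorem coeff_X_pow_mul_hGen (a e : ℕ) :
    PowerSeries.coeff a (PowerSeries.X ^ e * hGen) = h ((a : ℤ) - e) := by
  rw [PowerSeries.coeff_X_pow_mul']
  split_ifs with h1
  · rw [hGen, PowerSeries.coeff_mk, Nat.cast_sub h1]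
  · rw [h_of_neg (by omega)]

theorem det_mul_hGen (u : Fin n → PowerSeries Lam) :
    Matrix.det (Matrix.of fun i j => inVar i (u j * hGen)) =
      Matrix.det (Matrix.of fun i j => inVar i (u j)) * ∏ i, inVar i hGen := by
  rw [mul_comm, ← Matrix.det_mul_column]
  congr 1
  ext1 i j
  simp [mul_comm]

theorem expo_sub_stair (μ : YoungDiagram) (i j : Fin n) :
    ((expo n μ i : ℕ) : ℤ) - (stair n j : ℕ) = (μ.rowLen i : ℤ) - (i : ℤ) + (j : ℤ) := by
  have := i.is_lt
  have := j.is_lt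
  rw [expo, rowFun, stair_apply, stair_apply]
  omega

/-- `∏_{i < j} (t_i - t_j) ∏ H(t_i)`, the generating function of the Schur functions. -/
noncomputable def glGen (n : ℕ) : MvPowerSeries (Fin n) Lam :=
  vand MvPowerSeries.X * ∏ i, inVar i hGen

theorem glGen_eq_det : glGen n =
    Matrix.det (Matrix.of fun i j : Fin n => inVar i (PowerSeries.X ^ stair n j * hGen)) := by
  rw [det_mul_hGen, ← alt_X]
  rfl

theorem cf_glGen {μ : YoungDiagram} (hμ : μ.colLen 0 ≤ n) :
    cf (expo n μ) (glGen n) = sGl μ := by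
  rw [glGen_eq_det, cf_det_inVar, sGl_eq hμ]
  congr 1
  ext1 i j
  rw [Matrix.of_apply, Matrix.of_apply, coeff_X_pow_mul_hGen, expo_sub_stair]

theorem soGen_eq_det : glGen n * (ker 1 MvPowerSeries.X * kerDiag 1 MvPowerSeries.X) =
    Matrix.det (Matrix.of fun i j : Fin n => inVar i ((PowerSeries.X ^ stair n j -
      PowerSeries.X ^ (stair n j + 2 * (j : ℕ) + 2)) * hGen)) := by
  rw [det_mul_hGen, glGen, mul_right_comm, ← det_so_denominator]
  congr 2
  ext1 i j
  simp only [Matrix.of_apply, map_sub, map_pow, inVar_X]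

/-- The exponent `stair n j + 2 j + 2` lowers the index `μ_i - i + j` by `2 j + 2`, which gives the
second term `μ_i - i - j - 2`. -/
theorem cf_soGen {μ : YoungDiagram} (hμ : μ.colLen 0 ≤ n) :
    cf (expo n μ) (glGen n * (ker 1 MvPowerSeries.X * kerDiag 1 MvPowerSeries.X)) = sSo μ := by
  rw [soGen_eq_det, cf_det_inVar, sSo_eq hμ]
  congr 1
  ext1 i j
  rw [Matrix.of_apply, Matrix.of_apply, sub_mul, map_sub, coeff_X_pow_mul_hGen,
    coeff_X_pow_mul_hGen, expo_sub_stair]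
  congr 2
  have := expo_sub_stair μ i j
  push_cast
  omega

theorem spGen_eq_det : glGen n * ker 1 MvPowerSeries.X =
    Matrix.det (Matrix.of fun i j : Fin n => inVar i ((if (j : ℕ) = 0 then
      PowerSeries.X ^ stair n j else PowerSeries.X ^ stair n j +
      PowerSeries.X ^ (stair n j + 2 * (j : ℕ))) * hGen)) := by
  rw [det_mul_hGen, glGen, mul_right_comm, ← det_sp_denominator]
  congr 2
  ext1 i j
  simp only [Matrix.of_apply]
  split_ifs
  · simp only [map_pow, inVar_X]
  · simp only [map_add, map_pow, inVar_X]

theorem cf_spGen {μ : YoungDiagram} (hμ : μ.colLen 0 ≤ n) :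
    cf (expo n μ) (glGen n * ker 1 MvPowerSeries.X) = sSp μ := by
  rw [spGen_eq_det, cf_det_inVar, sSp_eq hμ]
  congr 1
  ext1 i j
  rw [Matrix.of_apply, Matrix.of_apply]
  have h1 := expo_sub_stair μ i j
  split_ifs with hj
  · rw [coeff_X_pow_mul_hGen, h1, hj]
    simp
  · rw [add_mul, map_add, coeff_X_pow_mul_hGen, coeff_X_pow_mul_hGen, h1]
    congr 2
    push_cast
    omega

theorem IsAlt.homogeneousComponent {R : Type*} [CommRing R] {f : MvPowerSeries (Fin n) R}
    (hf : IsAlt f) (a : ℕ) : IsAlt (MvPowerSeries.homogeneousComponent a f) := fun σ α => by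
  have h1 : (Finsupp.equivFunOnFinite.symm (α ∘ σ)).degree =
      (Finsupp.equivFunOnFinite.symm α).degree := by
    rw [Finsupp.degree_eq_sum, Finsupp.degree_eq_sum]
    exact Equiv.sum_comp σ α
  have h2 := hf σ α
  rw [cf] at h2 ⊢
  rw [MvPowerSeries.coeff_homogeneousComponent, h1, cf, MvPowerSeries.coeff_homogeneousComponent]
  split_ifs
  · exact h2
  · rw [mul_zero]

theorem cf_expo_homogeneousComponent {R : Type*} [CommRing R] {μ : YoungDiagram}
    (hμ : μ.colLen 0 ≤ n) (f : MvPowerSeries (Fin n) R) (a : ℕ) :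
    cf (expo n μ) (MvPowerSeries.homogeneousComponent a f) =
      if μ.card + ∑ i, stair n i = a then cf (expo n μ) f else 0 := by
  rw [cf, MvPowerSeries.coeff_homogeneousComponent, Finsupp.degree_eq_sum, ← sum_expo hμ]
  rfl

theorem IsAlt.homogeneousComponent_eq_zero {R : Type*} [CommRing R] [IsDomain R] [CharZero R]
    {f : MvPowerSeries (Fin n) R} (hf : IsAlt f) {a : ℕ} (ha : a < ∑ i, stair n i) :
    MvPowerSeries.homogeneousComponent a f = 0 :=
  (hf.homogeneousComponent a).eq_zero fun μ hμ => by
    rw [cf_expo_homogeneousComponent hμ, if_neg (by omega)]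

/-- The bound `a ≤ n` ensures that every partition of `a` fits into `n` rows, so that all the
alternants are visible. -/
theorem IsAlt.homogeneousComponent_eq_sum {R : Type*} [CommRing R] [IsDomain R] [CharZero R]
    {f : MvPowerSeries (Fin n) R} (hf : IsAlt f) {a : ℕ} (ha : a ≤ n) :
    MvPowerSeries.homogeneousComponent (a + ∑ i, stair n i) f =
      ∑ μ ∈ parts a, cf (expo n μ) f • alt MvPowerSeries.X (expo n μ) := by
  classical
  rw [← sub_eq_zero]
  refine ((hf.homogeneousComponent _).sub (IsAlt.sum fun ν _ =>
    (isAlt_alt _).smul _)).eq_zero fun ρ hρ => ?_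
  rw [map_sub, map_sum, cf_expo_homogeneousComponent hρ]
  simp_rw [map_smul]
  by_cases h1 : ρ ∈ parts a
  · rw [if_pos (by rw [mem_parts.1 h1]), Finset.sum_eq_single ρ]
    · rw [cf_alt_self (strictAnti_expo n ρ).injective, smul_eq_mul, mul_one, sub_self]
    · intro ν hν hne
      rw [cf_expo_alt hρ (colLen_le_of_mem_parts ha hν), if_neg hne.symm, smul_zero]
    · exact fun h' => absurd h1 h'
  · rw [if_neg, zero_sub, neg_eq_zero]
    · refine Finset.sum_eq_zero fun ν hν => ?_
      rw [cf_expo_alt hρ (colLen_le_of_mem_parts ha hν), if_neg, smul_zero]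
      rintro rfl
      exact h1 hν
    · rw [mem_parts] at h1
      omega

theorem alt_mul_schur_eq_sum {μ γ : YoungDiagram} (hn : μ.card + γ.card ≤ n) :
    alt (MvPowerSeries.X : Fin n → MvPowerSeries (Fin n) Lam) (expo n μ) *
      schur MvPowerSeries.X (rowFun n γ) =
        ∑ ν ∈ parts (μ.card + γ.card), lrCoeff μ γ ν • alt MvPowerSeries.X (expo n ν) := by
  have hμ : μ.colLen 0 ≤ n := (colLen_le_card μ).trans (by omega)
  have hγ : γ.colLen 0 ≤ n := (colLen_le_card γ).trans (by omega)
  have h1 := congrArg (fun f => vand MvPowerSeries.X * toVars n f) (lrCoeff_spec μ γ).2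
  simp only [map_mul, map_sum] at h1
  rw [← mul_assoc, vand_mul_toVars_sGl hμ, toVars_sGl hγ, Finset.mul_sum] at h1
  have h2 := congrArg (MvPowerSeries.map (Int.castRingHom Lam)) h1
  have hX : (fun i => MvPowerSeries.map (Int.castRingHom Lam) (MvPowerSeries.X i)) =
      (MvPowerSeries.X : Fin n → MvPowerSeries (Fin n) Lam) :=
    funext fun i => MvPowerSeries.map_X _ _
  rw [map_mul, ← alt_map, ← schur_map, hX, map_sum] at h2
  rw [h2]
  refine Finset.sum_congr rfl fun ν hν => ?_
  rw [map_zsmul, mul_smul_comm, vand_mul_toVars_sGl (colLen_le_of_mem_parts hn hν), map_zsmul,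
    ← alt_map, hX]

theorem ker_map {A B : Type*} [CommRing A] [CommRing B] (φ : A →+* B) (q : A) (t : Fin n → A) :
    φ (ker q t) = ker (φ q) fun i => φ (t i) := by
  rw [ker, ker, pairProd, pairProd, map_prod]
  refine Finset.prod_congr rfl fun i _ => ?_
  rw [map_prod]
  refine Finset.prod_congr rfl fun j _ => ?_
  rw [apply_ite φ, map_one, map_sub, map_one, map_mul, map_mul]

theorem kerDiag_map {A B : Type*} [CommRing A] [CommRing B] (φ : A →+* B) (q : A)
    (t : Fin n → A) : φ (kerDiag q t) = kerDiag (φ q) fun i => φ (t i) := by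
  rw [kerDiag, kerDiag, map_prod]
  refine Finset.prod_congr rfl fun i _ => ?_
  rw [map_sub, map_one, map_mul, map_mul]

theorem hom_ker {R : Type*} [CommRing R] :
    hom (ker 1 (MvPowerSeries.X : Fin n → MvPowerSeries (Fin n) R)) =
      ker (PowerSeries.X ^ 2) fun i => PowerSeries.C (MvPowerSeries.X i) := by
  rw [ker_map, ker, ker]
  congr 1
  ext1 i
  ext1 j
  rw [hom_X, hom_X, map_one]
  ring

theorem hom_kerDiag {R : Type*} [CommRing R] :
    hom (kerDiag 1 (MvPowerSeries.X : Fin n → MvPowerSeries (Fin n) R)) =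
      kerDiag (PowerSeries.X ^ 2) fun i => PowerSeries.C (MvPowerSeries.X i) := by
  rw [kerDiag_map, kerDiag, kerDiag]
  refine Finset.prod_congr rfl fun i _ => ?_
  rw [hom_X, map_one]
  ring

/-- Littlewood's identities weigh `2 k` boxes by `q^k`, while `hom` counts degree; substituting `q =
z²` reconciles the two. -/
theorem expand_ker {A : Type*} [CommRing A] (t : Fin n → A) :
    PowerSeries.expand 2 two_ne_zero (ker PowerSeries.X fun i => PowerSeries.C (t i)) =
      ker (PowerSeries.X ^ 2) fun i => PowerSeries.C (t i) := by
  have h1 := ker_map (PowerSeries.expand (R := A) 2 two_ne_zero).toRingHom PowerSeries.X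
    fun i => PowerSeries.C (t i)
  simpa only [AlgHom.toRingHom_eq_coe, RingHom.coe_coe, PowerSeries.expand_X,
    PowerSeries.expand_C] using h1

theorem expand_kerDiag {A : Type*} [CommRing A] (t : Fin n → A) :
    PowerSeries.expand 2 two_ne_zero (kerDiag PowerSeries.X fun i => PowerSeries.C (t i)) =
      kerDiag (PowerSeries.X ^ 2) fun i => PowerSeries.C (t i) := by
  have h1 := kerDiag_map (PowerSeries.expand (R := A) 2 two_ne_zero).toRingHom PowerSeries.X
    fun i => PowerSeries.C (t i)
  simpa only [AlgHom.toRingHom_eq_coe, RingHom.coe_coe, PowerSeries.expand_X,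
    PowerSeries.expand_C] using h1

theorem EvenParts.even_sum {f : Fin n → ℕ} (hf : EvenParts f) : Even (∑ i, f i) :=
  Finset.even_sum _ fun i _ => hf i

/-- The size is also the sum of the column lengths. -/
theorem EvenConj.even_sum {f : Fin n → ℕ} (hf : EvenConj f) : Even (∑ i, f i) := by
  classical
  have h1 : ∀ i, f i = ∑ j ∈ Finset.range (∑ i, f i), if j < f i then 1 else 0 := fun i => by
    rw [← Finset.card_filter]
    have h2 : f i ≤ ∑ i, f i := Finset.single_le_sum (fun _ _ => Nat.zero_le _) (Finset.mem_univ i)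
    conv_lhs => rw [← Finset.card_range (f i)]
    congr 1
    ext j
    simp only [Finset.mem_range, Finset.mem_filter]
    omega
  rw [Finset.sum_congr rfl fun i _ => h1 i, Finset.sum_comm]
  refine Finset.even_sum _ fun j _ => ?_
  rw [← Finset.card_filter]
  exact hf j

theorem coeff_expand_altSeries {A : Type*} [CommRing A] (t : Fin n → A)
    {P : (Fin n → ℕ) → Prop} (hP : ∀ f, P f → Even (∑ i, f i)) (b : ℕ) :
    PowerSeries.coeff b (PowerSeries.expand 2 two_ne_zero (altSeries t P)) = altSum t P b := by
  classical
  rw [PowerSeries.coeff_expand]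
  split_ifs with hb
  · rw [altSeries, PowerSeries.coeff_mk, Nat.mul_div_cancel' hb]
  · symm
    refine Finset.sum_eq_zero fun f hf => absurd ?_ hb
    rw [Finset.mem_filter, mem_antiFuns] at hf
    rw [← hf.1.1]
    exact (hP f hf.2).two_dvd

open Classical in
theorem altSum_eq_sum_parts {A : Type*} [CommRing A] (t : Fin n → A) {b : ℕ} (hb : b ≤ n)
    (Q : Set YoungDiagram) (P : (Fin n → ℕ) → Prop)
    (hQ : ∀ μ : YoungDiagram, μ.colLen 0 ≤ n → (μ ∈ Q ↔ P (rowFun n μ))) :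
    altSum t P b = vand t * ∑ γ ∈ parts b with γ ∈ Q, schur t (rowFun n γ) := by
  rw [altSum, ← sum_parts hb Q P hQ, Finset.mul_sum]
  exact Finset.sum_congr rfl fun γ _ => alt_add_stair t _

open Classical in
/-- The branching rule, for a family `s` with generating function `glGen * K`, where `1 / K` is the
generating function of the Schur functions of partitions in `Q`. -/
theorem branching (s : YoungDiagram → Lam) (Q : Set YoungDiagram)
    (K : MvPowerSeries (Fin n) Lam) (P : (Fin n → ℕ) → Prop)
    (hQ : ∀ μ : YoungDiagram, μ.colLen 0 ≤ n → (μ ∈ Q ↔ P (rowFun n μ)))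
    (hP : ∀ f, P f → Even (∑ i, f i))
    (hK : hom K * PowerSeries.expand 2 two_ne_zero (altSeries MvPowerSeries.X P) =
      PowerSeries.C (vand MvPowerSeries.X))
    (hs : ∀ μ : YoungDiagram, μ.colLen 0 ≤ n → cf (expo n μ) (glGen n * K) = s μ)
    (halt : IsAlt (glGen n * K)) {ν : YoungDiagram} (hν : ν.card ≤ n) :
    sGl ν = ∑ p ∈ Finset.HasAntidiagonal.antidiagonal ν.card, ∑ μ ∈ parts p.1,
      ∑ γ ∈ parts p.2 with γ ∈ Q, lrCoeff μ γ ν • s μ := by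
  have hνn : ν.colLen 0 ≤ n := (colLen_le_card ν).trans hν
  set δ := ∑ i, stair n i with hδ
  have h1 : hom (glGen n * K) * PowerSeries.expand 2 two_ne_zero (altSeries MvPowerSeries.X P) =
      hom (glGen n) * PowerSeries.C (vand MvPowerSeries.X) := by
    rw [map_mul, mul_assoc, hK]
  -- Comparison of the components of degree `|ν| + |δ|`, the degree of `a_{ν+δ}`.
  have h2 := congrArg (PowerSeries.coeff (ν.card + δ)) h1
  rw [PowerSeries.coeff_mul, PowerSeries.coeff_mul_C, coeff_hom] at h2
  have h3 : ∑ p ∈ Finset.HasAntidiagonal.antidiagonal (ν.card + δ),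
      PowerSeries.coeff p.1 (hom (glGen n * K)) * PowerSeries.coeff p.2
        (PowerSeries.expand 2 two_ne_zero (altSeries MvPowerSeries.X P)) =
      ∑ p ∈ Finset.HasAntidiagonal.antidiagonal ν.card,
        (∑ μ ∈ parts p.1, s μ • alt MvPowerSeries.X (expo n μ)) *
          (vand MvPowerSeries.X * ∑ γ ∈ parts p.2 with γ ∈ Q,
            schur MvPowerSeries.X (rowFun n γ)) := by
    symm
    -- An alternating series has no component of degree below `|δ|`, so only indices `p.1 ≥ δ`
    -- contribute; they are shifted by `δ`.
    refine Finset.sum_bij_ne_zero (fun p _ _ => (p.1 + δ, p.2)) ?_ ?_ ?_ ?_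
    · intro p hp _
      rw [Finset.HasAntidiagonal.mem_antidiagonal] at hp ⊢
      simp only
      omega
    · intro p hp _ q hq _ hpq
      rw [Prod.mk.injEq] at hpq
      exact Prod.ext (by omega) hpq.2
    · intro p hp h
      rw [Finset.HasAntidiagonal.mem_antidiagonal] at hp
      have h4 : δ ≤ p.1 := by
        by_contra h5
        rw [coeff_hom, halt.homogeneousComponent_eq_zero (not_le.1 h5), zero_mul] at h
        exact h rfl
      have h6 : (p.1 - δ, p.2) ∈ Finset.HasAntidiagonal.antidiagonal ν.card := by
        rw [Finset.HasAntidiagonal.mem_antidiagonal]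
        simp only
        omega
      refine ⟨(p.1 - δ, p.2), h6, ?_, Prod.ext (by simp only; omega) rfl⟩
      have h7 : p.1 = (p.1 - δ) + δ := by omega
      rw [h7, coeff_hom, halt.homogeneousComponent_eq_sum (by omega),
        coeff_expand_altSeries _ hP, altSum_eq_sum_parts _ (by omega) Q P hQ] at h
      rwa [Finset.sum_congr rfl fun μ hμ => by
        rw [← hs μ (colLen_le_of_mem_parts (by omega) hμ)]]
    · intro p hp _
      rw [Finset.HasAntidiagonal.mem_antidiagonal] at hp
      rw [coeff_hom, halt.homogeneousComponent_eq_sum (by omega),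
        coeff_expand_altSeries _ hP, altSum_eq_sum_parts _ (by omega) Q P hQ]
      rw [Finset.sum_congr rfl fun μ hμ => by
        rw [← hs μ (colLen_le_of_mem_parts (by omega) hμ)]]
  have h4 : MvPowerSeries.homogeneousComponent (ν.card + δ) (glGen n) =
      ∑ p ∈ Finset.HasAntidiagonal.antidiagonal ν.card,
        (∑ μ ∈ parts p.1, s μ • alt MvPowerSeries.X (expo n μ)) *
          ∑ γ ∈ parts p.2 with γ ∈ Q, schur MvPowerSeries.X (rowFun n γ) := by
    -- The bialternant formula puts a Vandermonde factor into each summand, matching the one on the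
    -- other side.
    refine mul_right_cancel₀ (vand_ne_zero (R := Lam) n) ?_
    rw [← h2, h3, Finset.sum_mul]
    refine Finset.sum_congr rfl fun p _ => ?_
    ring
  have h5 := congrArg (cf (expo n ν)) h4
  rw [cf_expo_homogeneousComponent hνn, if_pos rfl, cf_glGen hνn, map_sum] at h5
  rw [h5]
  refine Finset.sum_congr rfl fun p hp => ?_
  rw [Finset.HasAntidiagonal.mem_antidiagonal] at hp
  rw [Finset.sum_mul_sum, map_sum]
  refine Finset.sum_congr rfl fun μ hμ => ?_
  rw [map_sum]
  refine Finset.sum_congr rfl fun γ hγ => ?_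
  rw [Finset.mem_filter, mem_parts] at hγ
  rw [mem_parts] at hμ
  have h6 : μ.card + γ.card = ν.card := by omega
  rw [smul_mul_assoc, map_smul, alt_mul_schur_eq_sum (by omega), map_sum,
    Finset.sum_eq_single ν]
  · rw [map_zsmul, cf_alt_self (strictAnti_expo n ν).injective, smul_eq_mul, mul_smul_comm,
      mul_one]
  · intro ρ hρ hne
    rw [map_zsmul, cf_expo_alt hνn (colLen_le_of_mem_parts (by omega) hρ), if_neg hne.symm,
      smul_zero]
  · intro h'
    exact absurd (mem_parts.2 h6.symm) h'

open Classical in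
theorem branching_so (ν : YoungDiagram) :
    sGl ν = ∑ p ∈ Finset.HasAntidiagonal.antidiagonal ν.card, ∑ μ ∈ parts p.1,
      ∑ γ ∈ parts p.2 with γ ∈ evenRows, lrCoeff μ γ ν • sSo μ := by
  refine branching (n := ν.card) sSo evenRows
    (ker 1 MvPowerSeries.X * kerDiag 1 MvPowerSeries.X) EvenParts
    (fun μ hμ => mem_evenRows_iff hμ) (fun f hf => hf.even_sum) ?_ (fun μ hμ => cf_soGen hμ) ?_
    le_rfl
  · rw [map_mul, hom_ker, hom_kerDiag, ← expand_ker, ← expand_kerDiag, ← map_mul, ← map_mul,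
      evenParts_altSeries, PowerSeries.expand_C]
  · rw [soGen_eq_det]
    exact isAlt_det_inVar _

open Classical in
theorem branching_sp (ν : YoungDiagram) :
    sGl ν = ∑ p ∈ Finset.HasAntidiagonal.antidiagonal ν.card, ∑ μ ∈ parts p.1,
      ∑ γ ∈ parts p.2 with γ ∈ evenCols, lrCoeff μ γ ν • sSp μ := by
  refine branching (n := ν.card) sSp evenCols (ker 1 MvPowerSeries.X) EvenConj
    (fun μ hμ => mem_evenCols_iff hμ) (fun f hf => hf.even_sum) ?_ (fun μ hμ => cf_spGen hμ) ?_
    le_rfl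
  · rw [hom_ker, ← expand_ker, ← map_mul, evenConj_altSeries, PowerSeries.expand_C]
  · rw [spGen_eq_det]
    exact isAlt_det_inVar _

end Branching

/-! ### Convergence of the infinite products. -/

section Products

theorem factor_mul (i j : ℕ) : factor i j *
    (1 - PowerSeries.X * PowerSeries.C (MvPowerSeries.X i * MvPowerSeries.X j)) = 1 := by
  rw [mul_comm]
  exact PowerSeries.mul_invOfUnit _ _ (by simp)

theorem prod_subtype_eq_prod_fin {B : Type*} [CommRing B] (r : ℕ → ℕ → Prop) [DecidableRel r]
    (g : ℕ → ℕ → B) (n : ℕ) :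
    ∏ p ∈ (Finset.range n ×ˢ Finset.range n).subtype (fun p : ℕ × ℕ => r p.1 p.2), g p.1.1 p.1.2 =
      ∏ i : Fin n, ∏ j : Fin n, if r i j then g i j else 1 := by
  rw [Finset.prod_subtype_eq_prod_filter (f := fun p : ℕ × ℕ => g p.1 p.2), Finset.prod_filter,
    Finset.prod_product, ← Fin.prod_univ_eq_prod_range
      (fun i => ∏ j ∈ Finset.range n, if r i j then g i j else 1)]
  refine Finset.prod_congr rfl fun i _ => ?_
  rw [← Fin.prod_univ_eq_prod_range (fun j => if r i j then g i j else 1)]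

open Classical in
-- Each coefficient of the partial products is eventually constant. For fixed `k` and a monomial in
-- the first `n` variables, killing the other variables turns every factor outside the pairs below
-- `n` into `1`, and Littlewood's identity in `n` variables evaluates the rest.
theorem hasProd_factor (r : ℕ → ℕ → Prop) (Q : Set YoungDiagram)
    (P : ∀ n, (Fin n → ℕ) → Prop) (F : PowerSeries Lam)
    (hF : ∀ k, PowerSeries.coeff k F = ∑ ν ∈ parts (2 * k) with ν ∈ Q, sGl ν)
    (hQ : ∀ n, ∀ μ : YoungDiagram, μ.colLen 0 ≤ n → (μ ∈ Q ↔ P n (rowFun n μ)))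
    (hK : ∀ n, (∏ i : Fin n, ∏ j : Fin n, if r i j then 1 - PowerSeries.X *
      (PowerSeries.C (MvPowerSeries.X i : MvPowerSeries (Fin n) ℤ) *
        PowerSeries.C (MvPowerSeries.X j)) else 1) * altSeries MvPowerSeries.X (P n) =
          PowerSeries.C (vand MvPowerSeries.X)) :
    HasProd (fun p : {p : ℕ × ℕ // r p.1 p.2} => factor p.1.1 p.1.2)
      (PowerSeries.map Lam.subtype F) := by
  rw [HasProd, PowerSeries.WithPiTopology.tendsto_iff_coeff_tendsto]
  intro k
  rw [MvPowerSeries.WithPiTopology.tendsto_iff_coeff_tendsto]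
  intro m
  obtain ⟨n, hkn, m', rfl⟩ : ∃ n, 2 * k ≤ n ∧
      m ∈ Set.range (Finsupp.embDomain (Fin.valEmbedding (n := n)) (M := ℕ)) := by
    refine ⟨max (2 * k) (m.support.sup id + 1), le_max_left _ _, ?_⟩
    rw [Finsupp.mem_range_embDomain_iff]
    intro i hi
    have h1 : i ≤ m.support.sup id := Finset.le_sup (f := id) hi
    exact ⟨⟨i, by omega⟩, rfl⟩
  set s₀ := (Finset.range n ×ˢ Finset.range n).subtype (fun p : ℕ × ℕ => r p.1 p.2) with hs₀
  refine tendsto_nhds_of_eventually_eq ?_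
  rw [SummationFilter.unconditional_filter]
  filter_upwards [Filter.eventually_ge_atTop s₀] with s hs
  set κ : MvPowerSeries ℕ ℤ →+* MvPowerSeries (Fin n) ℤ :=
    (MvPowerSeries.killCompl (R := ℤ) Fin.valEmbedding).toRingHom with hκ
  have hκX : ∀ i : Fin n, κ (MvPowerSeries.X (i : ℕ)) = MvPowerSeries.X i := fun i =>
    MvPowerSeries.killCompl_X (R := ℤ) (e := Fin.valEmbedding) i
  have hκX0 : ∀ i, n ≤ i → κ (MvPowerSeries.X i) = 0 := fun i hi =>
    MvPowerSeries.killCompl_X_eq_zero (R := ℤ) (e := Fin.valEmbedding) (by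
      rintro ⟨j, rfl⟩
      exact absurd j.is_lt (not_lt.2 hi))
  set E := PowerSeries.map κ (∏ p ∈ s, factor p.1.1 p.1.2) with hE
  set g : ℕ → ℕ → PowerSeries (MvPowerSeries (Fin n) ℤ) := fun i j =>
    1 - PowerSeries.X * (PowerSeries.C (κ (MvPowerSeries.X i)) *
      PowerSeries.C (κ (MvPowerSeries.X j))) with hg
  have h1 : E * ∏ p ∈ s, g p.1.1 p.1.2 = 1 := by
    rw [hE, map_prod, ← Finset.prod_mul_distrib]
    refine Finset.prod_eq_one fun p _ => ?_
    have h2 := congrArg (PowerSeries.map κ) (factor_mul p.1.1 p.1.2)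
    rwa [map_mul, map_sub, map_one, map_mul, PowerSeries.map_X, PowerSeries.map_C, map_mul κ,
      map_mul PowerSeries.C] at h2
  have h2 : ∏ p ∈ s, g p.1.1 p.1.2 = ∏ i : Fin n, ∏ j : Fin n, if r i j then 1 - PowerSeries.X *
      (PowerSeries.C (MvPowerSeries.X i : MvPowerSeries (Fin n) ℤ) *
        PowerSeries.C (MvPowerSeries.X j)) else 1 := by
    rw [← Finset.prod_subset hs]
    · refine (prod_subtype_eq_prod_fin r g n).trans ?_
      simp only [hg, hκX]
    · intro p _ hp
      rw [hs₀, Finset.mem_subtype, Finset.mem_product, Finset.mem_range, Finset.mem_range,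
        not_and_or, not_lt, not_lt] at hp
      simp only [hg]
      rcases hp with hp | hp
      · rw [hκX0 _ hp]
        simp
      · rw [hκX0 _ hp]
        simp
  have h3 : altSeries MvPowerSeries.X (P n) = PowerSeries.C (vand MvPowerSeries.X) * E := by
    rw [← hK n, ← h2, mul_right_comm, mul_comm _ E, h1, one_mul]
  -- Since `2 k ≤ n`, every partition of `2 k` has at most `n` rows, so none is lost in `n`
  -- variables.
  have h4 := congrArg (PowerSeries.coeff k) h3
  rw [PowerSeries.coeff_C_mul, altSeries, PowerSeries.coeff_mk,
    altSum_eq_sum_parts _ hkn Q (P n) (hQ n)] at h4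
  have h5 := mul_left_cancel₀ (vand_ne_zero (R := ℤ) n) h4
  rw [Finset.sum_congr rfl fun ν hν => (toVars_sGl (colLen_le_of_mem_parts hkn
    (Finset.mem_filter.1 hν).1)).symm, ← map_sum, ← hF] at h5
  have h6 := congrArg (MvPowerSeries.coeff m') h5
  rw [coeff_toVars, hE, PowerSeries.coeff_map] at h6
  rw [PowerSeries.coeff_map]
  exact h6.symm

end Products

/-! ### Finiteness and assembly of the multiplicities. -/

section Multiplicities

/-- The partitions of size at most `n`. -/
noncomputable def smallParts (n : ℕ) : Finset YoungDiagram := by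
  classical exact (Finset.range (n + 1)).biUnion parts

theorem mem_smallParts {n : ℕ} {μ : YoungDiagram} : μ ∈ smallParts n ↔ μ.card ≤ n := by
  simp [smallParts, mem_parts]

open Classical in
-- The size constraint is already enforced by the support of `g`, so the sum may run over a box that
-- does not depend on `μ`; this allows the exchange of summations.
theorem sum_antidiagonal_parts {B : Type*} [AddCommMonoid B] (n : ℕ) (Q : Set YoungDiagram)
    (g : YoungDiagram → YoungDiagram → B) (hg : ∀ μ γ, g μ γ ≠ 0 → μ.card + γ.card = n) :
    ∑ p ∈ Finset.HasAntidiagonal.antidiagonal n, ∑ μ ∈ parts p.1, ∑ γ ∈ parts p.2 with γ ∈ Q,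
      g μ γ = ∑ μ ∈ smallParts n, ∑ γ ∈ smallParts n with γ ∈ Q, g μ γ := by
  rw [← Finset.sum_product', ← Finset.sum_filter_of_ne
    (p := fun x : YoungDiagram × YoungDiagram => x.1.card + x.2.card = n) fun x _ h => hg _ _ h,
    ← Finset.sum_fiberwise_of_maps_to (t := Finset.HasAntidiagonal.antidiagonal n)
      (g := fun x : YoungDiagram × YoungDiagram => (x.1.card, x.2.card))]
  · refine Finset.sum_congr rfl fun p hp => ?_
    rw [Finset.HasAntidiagonal.mem_antidiagonal] at hp
    rw [← Finset.sum_product']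
    refine Finset.sum_congr ?_ fun _ _ => rfl
    ext ⟨μ, γ⟩
    simp only [Finset.mem_product, Finset.mem_filter, mem_parts, mem_smallParts, Prod.ext_iff]
    constructor
    · rintro ⟨h1, h2, h3⟩
      exact ⟨⟨⟨by omega, by omega, h3⟩, by omega⟩, h1, h2⟩
    · rintro ⟨⟨⟨-, -, h3⟩, -⟩, h1, h2⟩
      exact ⟨h1, h2, h3⟩
  · intro x hx
    rw [Finset.mem_filter] at hx
    exact Finset.HasAntidiagonal.mem_antidiagonal.2 hx.2

theorem finite_lrCoeff (Q Q' : Set YoungDiagram) (k : ℕ) :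
    {t : YoungDiagram × YoungDiagram × YoungDiagram |
      t.2.1 ∈ Q ∧ t.2.1.card = 2 * k ∧ t.2.2 ∈ Q' ∧ lrCoeff t.1 t.2.2 t.2.1 ≠ 0}.Finite := by
  refine ((smallParts (2 * k) ×ˢ smallParts (2 * k) ×ˢ smallParts (2 * k)).finite_toSet).subset ?_
  rintro ⟨μ, ν, γ⟩ ⟨-, h1, -, h2⟩
  have h3 := (lrCoeff_spec μ γ).1 ν h2
  simp only at h1
  simp only [Finset.mem_coe, Finset.mem_product, mem_smallParts]
  omega

open Classical in
theorem finsum_lrCoeff (Q Q' : Set YoungDiagram) (k : ℕ) (μ : YoungDiagram) :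
    ∑ᶠ ν ∈ {ν : YoungDiagram | ν ∈ Q ∧ ν.card = 2 * k}, ∑ᶠ γ ∈ Q', lrCoeff μ γ ν =
      ∑ ν ∈ parts (2 * k) with ν ∈ Q, ∑ γ ∈ smallParts (2 * k) with γ ∈ Q', lrCoeff μ γ ν := by
  have h1 : {ν : YoungDiagram | ν ∈ Q ∧ ν.card = 2 * k} =
      ((parts (2 * k)).filter (· ∈ Q) : Finset YoungDiagram) := by
    ext ν
    simp [mem_parts, and_comm]
  rw [h1, finsum_mem_coe_finset]
  refine Finset.sum_congr rfl fun ν hν => ?_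
  rw [Finset.mem_filter, mem_parts] at hν
  refine finsum_mem_eq_sum_of_inter_support_eq _ ?_
  ext γ
  simp only [Set.mem_inter_iff, Function.mem_support, Finset.coe_filter, mem_smallParts]
  refine and_congr_left fun h2 => ?_
  have h3 := (lrCoeff_spec μ γ).1 ν h2
  refine ⟨fun h => ⟨by omega, h⟩, fun h => h.2⟩

open Classical in
-- Exchange the sums over `μ` and `ν`; for fixed `ν` the inner sum is the branching rule.
theorem finsum_smul_eq_sum_sGl (Q Q' : Set YoungDiagram) (s : YoungDiagram → Lam) (k : ℕ)
    (hs : ∀ ν, sGl ν = ∑ p ∈ Finset.HasAntidiagonal.antidiagonal ν.card, ∑ μ ∈ parts p.1,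
      ∑ γ ∈ parts p.2 with γ ∈ Q', lrCoeff μ γ ν • s μ) :
    ∑ᶠ μ : YoungDiagram, (∑ᶠ ν ∈ {ν : YoungDiagram | ν ∈ Q ∧ ν.card = 2 * k},
      ∑ᶠ γ ∈ Q', lrCoeff μ γ ν) • s μ = ∑ ν ∈ parts (2 * k) with ν ∈ Q, sGl ν := by
  simp_rw [finsum_lrCoeff]
  rw [finsum_eq_sum_of_support_subset (s := smallParts (2 * k))]
  · simp_rw [Finset.sum_smul]
    rw [Finset.sum_comm]
    refine Finset.sum_congr rfl fun ν hν => ?_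
    rw [Finset.mem_filter, mem_parts] at hν
    rw [hs ν, sum_antidiagonal_parts ν.card Q' fun μ γ => lrCoeff μ γ ν • s μ, hν.1]
    intro μ γ h
    exact ((lrCoeff_spec μ γ).1 ν fun h' => h (by rw [h', zero_smul])).symm
  · intro μ hμ
    by_contra h
    apply hμ
    rw [Finset.mem_coe, mem_smallParts] at h
    have : ∀ ν ∈ (parts (2 * k)).filter (· ∈ Q),
        ∑ γ ∈ smallParts (2 * k) with γ ∈ Q', lrCoeff μ γ ν = 0 := fun ν hν => by
      rw [Finset.mem_filter, mem_parts] at hν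
      refine Finset.sum_eq_zero fun γ _ => ?_
      by_contra h2
      have := (lrCoeff_spec μ γ).1 ν h2
      omega
    simp only
    rw [Finset.sum_eq_zero this, zero_smul]

theorem prod_lt_eq_ker {A : Type*} [CommRing A] {n : ℕ} (q : A) (t : Fin n → A) :
    (∏ i : Fin n, ∏ j : Fin n, if (i : ℕ) < j then 1 - q * (t i * t j) else 1) = ker q t := rfl

theorem prod_le_eq_ker_mul {A : Type*} [CommRing A] {n : ℕ} (q : A) (t : Fin n → A) :
    (∏ i : Fin n, ∏ j : Fin n, if (i : ℕ) ≤ j then 1 - q * (t i * t j) else 1) =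
      ker q t * kerDiag q t := by
  rw [ker, kerDiag, pairProd, ← Finset.prod_mul_distrib]
  refine Finset.prod_congr rfl fun i _ => ?_
  have : ∀ j : Fin n, (if (i : ℕ) ≤ j then 1 - q * (t i * t j) else 1) =
      (if i < j then 1 - q * (t i * t j) else 1) *
        if i = j then 1 - q * (t i * t j) else 1 := fun j => by
    rcases lt_trichotomy i j with h | h | h
    · rw [if_pos (Fin.le_def.1 h.le), if_pos h, if_neg h.ne, mul_one]
    · rw [if_pos (Fin.le_def.1 h.le), if_neg h.not_lt, if_pos h, one_mul]
    · rw [if_neg (by rw [Fin.lt_def] at h; omega), if_neg h.not_gt, if_neg h.ne', mul_one]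
  simp_rw [this, Finset.prod_mul_distrib]
  simp

theorem isCharSo_mk : IsCharSo (PowerSeries.mk fun k =>
    ∑ᶠ μ : YoungDiagram, mSo k μ • sSo μ) := by
  classical
  refine hasProd_factor (· < ·) evenCols (fun _ => EvenConj) _ (fun k => ?_)
    (fun n μ hμ => mem_evenCols_iff hμ) fun n => ?_
  · rw [PowerSeries.coeff_mk]
    exact finsum_smul_eq_sum_sGl evenCols evenRows sSo k branching_so
  · rw [← evenConj_altSeries, ← prod_lt_eq_ker]
    congr!

theorem isCharSp_mk : IsCharSp (PowerSeries.mk fun k =>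
    ∑ᶠ μ : YoungDiagram, mSp k μ • sSp μ) := by
  classical
  refine hasProd_factor (· ≤ ·) evenRows (fun _ => EvenParts) _ (fun k => ?_)
    (fun n μ hμ => mem_evenRows_iff hμ) fun n => ?_
  · rw [PowerSeries.coeff_mk]
    exact finsum_smul_eq_sum_sGl evenRows evenCols sSp k branching_sp
  · rw [← evenParts_altSeries, ← prod_le_eq_ker_mul]
    congr!

end Multiplicities

end UniversalCharacters

theorem mainTheorem10 :
    ((∀ k : ℕ, {t : YoungDiagram × YoungDiagram × YoungDiagram |
        t.2.1 ∈ UniversalCharacters.evenCols ∧ t.2.1.card = 2 * k ∧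
        t.2.2 ∈ UniversalCharacters.evenRows ∧
        UniversalCharacters.lrCoeff t.1 t.2.2 t.2.1 ≠ 0}.Finite) ∧
      UniversalCharacters.IsCharSo (PowerSeries.mk fun k =>
        ∑ᶠ μ : YoungDiagram, UniversalCharacters.mSo k μ • UniversalCharacters.sSo μ)) ∧
    ((∀ k : ℕ, {t : YoungDiagram × YoungDiagram × YoungDiagram |
        t.2.1 ∈ UniversalCharacters.evenRows ∧ t.2.1.card = 2 * k ∧
        t.2.2 ∈ UniversalCharacters.evenCols ∧
        UniversalCharacters.lrCoeff t.1 t.2.2 t.2.1 ≠ 0}.Finite) ∧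
      UniversalCharacters.IsCharSp (PowerSeries.mk fun k =>
        ∑ᶠ μ : YoungDiagram, UniversalCharacters.mSp k μ • UniversalCharacters.sSp μ)) := by
  open UniversalCharacters in
  exact ⟨⟨finite_lrCoeff evenCols evenRows, isCharSo_mk⟩,
    ⟨finite_lrCoeff evenRows evenCols, isCharSp_mk⟩⟩
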